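/- Identify the split quaternions $\mathbb H_{\mathbb R}=\left\{X=\begin{pmatrix} x_1-ix_2 & x_3+ix_4\\ x_3-ix_4 & x_1+ix_2\end{pmatrix}\right\}$ with $\mathbb R^4$ through the coordinates $(x_1,x_2,x_3,x_4)$, and put $N(X)=\det X=x_1^2+x_2^2-x_3^2-x_4^2$. For $\xi=(\xi_1,\xi_2,\xi_3,\xi_4)$ in the dual space put $\xi\cdot X=\xi_1x_1+\xi_2x_2+\xi_3x_3+\xi_4x_4$ and $\langle\xi,\xi\rangle=\xi_1^2+\xi_2^2-\xi_3^2-\xi_4^2$. The Fourier transform of a Schwartz function is normalized by $$\hat\psi(\xi)=\frac1{(2\pi)^2}\int_{\mathbb H_{\mathbb R}}\psi(X)\,e^{i\xi\cdot X}\,dV,$$ and it is extended to tempered distributions by $\langle\hat T,\varphi\rangle=\langle T,\hat\varphi\rangle$. Let $J_0$ and $Y_0$ be the Bessel functions of the first and second kind and $K_0$ the modified Bessel function of the second kind, of order zero. **Proposition.** Let $R>0$. For each choice of the sign $\pm$, the limits $$\bigl(N(X)-R^2\pm i0\bigr)^{-2}=\lim_{\varepsilon\to0^+}\bigl(N(X)-R^2\pm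 i\varepsilon\bigr)^{-2},\qquad \bigl(N(X)+R^2\pm i0\bigr)^{-2}=\lim_{\varepsilon\to0^+}\bigl(N(X)+R^2\pm i\varepsilon\bigr)^{-2}$$ exist in the sense of tempered distributions (that is, tested against every Schwartz function). Their Fourier transforms are the tempered distributions $\varphi\mapsto\int F(\xi)\varphi(\xi)\,d\xi$ (absolutely convergent integrals for every Schwartz function $\varphi$) given by the following functions $F$, defined off the null set $\langle\xi,\xi\rangle=0$: $$\Bigl(\bigl(N(X)-R^2\pm i0\bigr)^{-2}\Bigr)^{\wedge}(\xi)=\begin{cases}\frac{\pi}4Y_0\bigl(R\sqrt{\langle\xi,\xi\rangle}\bigr)\pm i\frac{\pi}4J_0\bigl(R\sqrt{\langle\xi,\xi\rangle}\bigr), & \langle\xi,\xi\rangle>0,\\[2pt] -\frac12K_0\bigl(R\sqrt{-\langle\xi,\xi\rangle}\bigr), & \langle\xi,\xi\rangle<0,\end{cases}$$ $$\Bigl(\bigl(N(X)+R^2\pm i0\bigr)^{-2}\Bigr)^{\wedge}(\xi)=\begin{cases}-\frac12K_0\bigl(R\sqrt{\langle\xi,\xi\rangle}\bigr), & \langle\xi,\xi\rangle>0,\\[2pt]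 \frac{\pi}4Y_0\bigl(R\sqrt{-\langle\xi,\xi\rangle}\bigr)\mp i\frac{\pi}4J_0\bigl(R\sqrt{-\langle\xi,\xi\rangle}\bigr), & \langle\xi,\xi\rangle<0.\end{cases}$$ -/

import Mathlib

open MeasureTheory Filter Topology
open scoped SchwartzMap

/-- The split quaternions `X = x₁ e₀ + x₃ ẽ₁ + x₄ ẽ₂ + x₂ e₃` in the coordinates `(x₁, x₂, x₃, x₄)`
(numbered from `0` below), with the Euclidean structure used for Lebesgue measure, for Schwartz
functions, and for identifying the dual space through `ξ · X = ∑ ξⱼ xⱼ`. -/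
abbrev SplitQuat : Type := EuclideanSpace ℝ (Fin 4)

namespace SplitQuat

/-- The `2 × 2` complex matrix of a split quaternion. -/
noncomputable def toMatrix (X : SplitQuat) : Matrix (Fin 2) (Fin 2) ℂ :=
  !![(X 0 : ℂ) - Complex.I * X 1, (X 2 : ℂ) + Complex.I * X 3;
     (X 2 : ℂ) - Complex.I * X 3, (X 0 : ℂ) + Complex.I * X 1]

/-- The norm form `N(X) = x₁² + x₂² - x₃² - x₄²`, which is the determinant of `X` as a matrix. -/
def N (X : SplitQuat) : ℝ := X 0 ^ 2 + X 1 ^ 2 - X 2 ^ 2 - X 3 ^ 2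

theorem det_toMatrix (X : SplitQuat) : X.toMatrix.det = (N X : ℂ) := by
  simp only [toMatrix, Matrix.det_fin_two_of, N]
  push_cast
  linear_combination (-(X 1 : ℂ) ^ 2 + (X 3 : ℂ) ^ 2) * Complex.I_sq

/-- The bilinear form of signature `(2, 2)` on the dual space. -/
def dualForm (ξ η : SplitQuat) : ℝ := ξ 0 * η 0 + ξ 1 * η 1 - ξ 2 * η 2 - ξ 3 * η 3

/-- The Fourier transform `φ ↦ (X ↦ (2π)⁻² ∫ φ(ξ) e^{i ξ · X} dξ)` on Schwartz functions, obtained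
by rescaling the one of Mathlib; the next theorem is the integral formula. -/
noncomputable def fourierSchwartz : 𝓢(SplitQuat, ℂ) →L[ℂ] 𝓢(SplitQuat, ℂ) :=
  (((2 * Real.pi) ^ 2 : ℝ) : ℂ)⁻¹ •
    ((SchwartzMap.compCLMOfContinuousLinearEquiv ℂ
        (ContinuousLinearEquiv.smulLeft (M₁ := SplitQuat) (R₁ := ℝ)
          (Units.mk0 (-(2 * Real.pi)⁻¹) (by simp [Real.pi_ne_zero])))) ∘L
      (FourierTransform.fourierCLM ℂ 𝓢(SplitQuat, ℂ)))

theorem fourierSchwartz_apply (φ : 𝓢(SplitQuat, ℂ)) (X : SplitQuat) :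
    fourierSchwartz φ X =
      (((2 * Real.pi) ^ 2 : ℝ) : ℂ)⁻¹ *
        ∫ ξ : SplitQuat, φ ξ * Complex.exp (Complex.I * ((∑ j, ξ j * X j : ℝ) : ℂ)) := by
  change (((2 * Real.pi) ^ 2 : ℝ) : ℂ)⁻¹ *
    FourierTransform.fourier (φ : SplitQuat → ℂ) (-(2 * Real.pi)⁻¹ • X) = _
  rw [Real.fourier_eq']
  congr 2
  funext ξ
  have hin : inner ℝ ξ X = ∑ j, ξ j * X j := by
    simp [PiLp.inner_apply, mul_comm]
  rw [smul_eq_mul, mul_comm, inner_smul_right, ← hin]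
  congr 2
  have h : (-2 * Real.pi * (-(2 * Real.pi)⁻¹ * inner ℝ ξ X) : ℝ) = inner ℝ ξ X := by
    field_simp [Real.pi_ne_zero]
  rw [h, mul_comm]

/-- The Fourier transform of a tempered distribution, `⟨T^, φ⟩ = ⟨T, φ^⟩`. -/
noncomputable def fourierDistribution (T : 𝓢'(SplitQuat, ℂ)) : 𝓢'(SplitQuat, ℂ) :=
  PointwiseConvergenceCLM.precomp ℂ fourierSchwartz T

theorem fourierDistribution_apply (T : 𝓢'(SplitQuat, ℂ)) (φ : 𝓢(SplitQuat, ℂ)) :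
    fourierDistribution T φ = T (fourierSchwartz φ) := rfl

/-- The tempered distribution `T` is the function `f`: `⟨T, φ⟩ = ∫ f φ`, with an absolutely
convergent integral, for every Schwartz function `φ`. -/
def IsGivenBy (T : 𝓢'(SplitQuat, ℂ)) (f : SplitQuat → ℂ) : Prop :=
  ∀ φ : 𝓢(SplitQuat, ℂ),
    Integrable (fun ξ => f ξ * φ ξ) ∧ T φ = ∫ ξ, f ξ * φ ξ

/-- The tempered distribution `T` is `(N(X) + c + s i0)⁻²`, that is, the limit as `ε → 0⁺` of the
functions `(N(X) + c + s i ε)⁻²` in the sense of tempered distributions. -/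
def IsInvSqBoundaryValue (c s : ℝ) (T : 𝓢'(SplitQuat, ℂ)) : Prop :=
  ∀ φ : 𝓢(SplitQuat, ℂ),
    Tendsto
      (fun ε : ℝ => ∫ X, φ X / (((N X + c : ℝ) : ℂ) + ((s * ε : ℝ) : ℂ) * Complex.I) ^ 2)
      (𝓝[>] 0) (𝓝 (T φ))

/-- For `s ε ≠ 0` the integrals above converge absolutely. -/
theorem integrable_invSq (c η : ℝ) (hη : η ≠ 0) (φ : 𝓢(SplitQuat, ℂ)) :
    Integrable (fun X => φ X / (((N X + c : ℝ) : ℂ) + (η : ℂ) * Complex.I) ^ 2) := by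
  have him : ∀ X : SplitQuat, |η| ≤ ‖((N X + c : ℝ) : ℂ) + (η : ℂ) * Complex.I‖ := fun X => by
    simpa using Complex.abs_im_le_norm (((N X + c : ℝ) : ℂ) + (η : ℂ) * Complex.I)
  have hpos : 0 < |η| := abs_pos.mpr hη
  have hne : ∀ X : SplitQuat, (((N X + c : ℝ) : ℂ) + (η : ℂ) * Complex.I) ^ 2 ≠ 0 := fun X =>
    pow_ne_zero 2 (norm_pos_iff.mp (hpos.trans_le (him X)))
  have hc : Continuous fun X : SplitQuat => (((N X + c : ℝ) : ℂ) + (η : ℂ) * Complex.I) ^ 2 := by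
    unfold N
    fun_prop
  refine (φ.integrable (μ := volume).norm.mul_const ((|η| ^ 2)⁻¹)).mono'
    (φ.continuous.div hc hne).aestronglyMeasurable (Eventually.of_forall fun X => ?_)
  rw [norm_div, norm_pow, div_eq_mul_inv]
  gcongr
  exact him X

end SplitQuat

/-- The Bessel function of the first kind `J₀`. -/
noncomputable def besselJ0 (x : ℝ) : ℝ :=
  ∑' k : ℕ, (-1) ^ k / (k.factorial : ℝ) ^ 2 * (x / 2) ^ (2 * k)

/-- The modified Bessel function of the first kind `I₀`. -/
noncomputable def besselI0 (x : ℝ) : ℝ :=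
  ∑' k : ℕ, 1 / (k.factorial : ℝ) ^ 2 * (x / 2) ^ (2 * k)

/-- The Bessel function of the second kind `Y₀`, for `x > 0`; here
`harmonic k = 1 + 1/2 + ⋯ + 1/k`. -/
noncomputable def besselY0 (x : ℝ) : ℝ :=
  2 / Real.pi * ((Real.log (x / 2) + Real.eulerMascheroniConstant) * besselJ0 x
    + ∑' k : ℕ, (-1) ^ (k + 1) * (harmonic k : ℝ) / (k.factorial : ℝ) ^ 2 * (x / 2) ^ (2 * k))

/-- The modified Bessel function of the second kind `K₀`, for `x > 0`. -/
noncomputable def besselK0 (x : ℝ) : ℝ :=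
  -(Real.log (x / 2) + Real.eulerMascheroniConstant) * besselI0 x
    + ∑' k : ℕ, (harmonic k : ℝ) / (k.factorial : ℝ) ^ 2 * (x / 2) ^ (2 * k)

namespace SplitQuat

/-- The function `ξ ↦ (π/4) Y₀(R √⟨ξ,ξ⟩) + s i (π/4) J₀(R √⟨ξ,ξ⟩)` for `⟨ξ,ξ⟩ > 0` and
`ξ ↦ -(1/2) K₀(R √(-⟨ξ,ξ⟩))` for `⟨ξ,ξ⟩ < 0` (the value on the cone `⟨ξ,ξ⟩ = 0`, a null set, is
immaterial). -/
noncomputable def kernelMinus (R s : ℝ) (ξ : SplitQuat) : ℂ :=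
  if 0 < dualForm ξ ξ then
    ((Real.pi / 4 * besselY0 (R * √(dualForm ξ ξ)) : ℝ) : ℂ)
      + Complex.I * ((s * (Real.pi / 4) * besselJ0 (R * √(dualForm ξ ξ)) : ℝ) : ℂ)
  else if dualForm ξ ξ < 0 then
    ((-(1 / 2) * besselK0 (R * √(-dualForm ξ ξ)) : ℝ) : ℂ)
  else 0

/-- The function `ξ ↦ -(1/2) K₀(R √⟨ξ,ξ⟩)` for `⟨ξ,ξ⟩ > 0` and
`ξ ↦ (π/4) Y₀(R √(-⟨ξ,ξ⟩)) - s i (π/4) J₀(R √(-⟨ξ,ξ⟩))` for `⟨ξ,ξ⟩ < 0`. -/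
noncomputable def kernelPlus (R s : ℝ) (ξ : SplitQuat) : ℂ :=
  if 0 < dualForm ξ ξ then
    ((-(1 / 2) * besselK0 (R * √(dualForm ξ ξ)) : ℝ) : ℂ)
  else if dualForm ξ ξ < 0 then
    ((Real.pi / 4 * besselY0 (R * √(-dualForm ξ ξ)) : ℝ) : ℂ)
      - Complex.I * ((s * (Real.pi / 4) * besselJ0 (R * √(-dualForm ξ ξ)) : ℝ) : ℂ)
  else 0

end SplitQuat

/-!
Write `q = N ξ`, take `s = ±1`, and for `w` in the slit plane let
`besselL w = -(log w + 2γ) ∑ w^k/k!² + 2 ∑ H_k w^k/k!²`, which is `2 K₀(2√w)`.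

For `ε > 0`, with `a = ε - i s c`, the function `(N + c + i s ε)⁻²` is the superposition
`-∫₀^∞ t e^{-at} e^{i s t N} dt` of imaginary Gaussians. Since `N` has signature `(2, 2)`, the Fourier
transform of `e^{i s t N}` is `(4t²)⁻¹ e^{-i s q/(4t)}`, without any phase factor
(`integral_fourierSchwartz_mul_cexp_N`). So the Fourier transform of `(N + c + i s ε)⁻²` should be
`-¼ ∫₀^∞ e^{-at - b/t} dt/t` with `b = i s q/4`. As this integral does not converge absolutely at
`t = 0`, a factor `e^{-δ/t}` is inserted, which replaces `b` by `δ + i s q/4` and justifies Fubini's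
theorem; then `δ → 0`.

Two facts about `M(a, b) = ∫₀^∞ e^{-at - b/t} dt/t`, for `a` and `b` in the right half-plane, carry
the proof.

* `M(a, b) = besselL (a b)` (`besselM_eq_besselL`). Along the ray `τ ↦ (τ a, b)` both sides solve
  `τ f'' + f' = a b f`, and both are `-log τ - log a - log b - 2γ + o(1)` at `τ = 0`; the constant
  comes from `∫₀^∞ log t e^{-at} dt = -(γ + log a)/a`. An energy estimate shows that a solution which
  vanishes at the singular point `τ = 0` is zero.
* `|besselL w| ≤ 6 |w|^{-1/4}` on the whole slit plane (`norm_besselL_le`). By the first fact it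
  suffices to bound `M(a, a)` for `a² = w`, where an integration by parts away from the stationary
  point `t = 1` of the phase `t + 1/t` gives `6 |a|^{-1/2}`.

As `|q|^{-1/4}` is integrable against every Schwartz function, the bound makes both limits `δ → 0` and
`ε → 0` instances of dominated convergence. The first one gives the Fourier transform
`-¼ besselL ((c q + i s ε q)/4)` of `(N + c + i s ε)⁻²`. In the second one the argument tends to the
positive axis if `c q > 0`, which gives `K₀`, and to the side of the cut determined by the sign of
`s q` if `c q < 0`, where `log w` contributes `± i π` and `besselL` becomes a combination of `Y₀`
and `J₀`.
-/

/-! ### Laplace transforms on the right half-plane and the integral of the logarithm -/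

namespace BesselK
open Set

/-- `f` is integrable on `(0, ∞)` against every decaying exponential, so that its Laplace
transform exists on the whole right half-plane. -/
def LaplaceIntegrable (f : ℝ → ℂ) : Prop :=
  ∀ r : ℝ, 0 < r → Integrable (fun t => f t * (Real.exp (-r * t) : ℂ)) (volume.restrict (Ioi 0))

/-- The Laplace transform `a ↦ ∫₀^∞ f(t) e^{-at} dt`. -/
noncomputable def laplace (f : ℝ → ℂ) (a : ℂ) : ℂ := ∫ t in Ioi (0 : ℝ), f t * Complex.exp (-a * t)

theorem norm_cexp_neg_mul_ofReal (a : ℂ) (t : ℝ) :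
    ‖Complex.exp (-a * t)‖ = Real.exp (-a.re * t) := by
  simp [Complex.norm_exp]

theorem LaplaceIntegrable.integrable {f : ℝ → ℂ} (hf : LaplaceIntegrable f) {a : ℂ}
    (ha : 0 < a.re) :
    Integrable (fun t : ℝ => f t * Complex.exp (-a * t)) (volume.restrict (Ioi 0)) := by
  have h := hf a.re ha
  have h2 : (fun t : ℝ => f t * Complex.exp (-a * t)) =
      fun t : ℝ => Complex.exp (-(a.im * t : ℝ) * Complex.I) *
        (f t * (Real.exp (-a.re * t) : ℂ)) := by
    funext t
    rw [mul_left_comm, Complex.ofReal_exp, ← Complex.exp_add]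
    congr 2
    nth_rewrite 1 [← Complex.re_add_im a]
    push_cast
    ring
  rw [h2]
  refine Integrable.bdd_mul h (c := 1) (by fun_prop) (Eventually.of_forall fun t => ?_)
  rw [← Complex.ofReal_neg, Complex.norm_exp_ofReal_mul_I]

theorem LaplaceIntegrable.id_mul {f : ℝ → ℂ} (hf : LaplaceIntegrable f) :
    LaplaceIntegrable (fun t => t * f t) := by
  intro r hr
  have h := (hf (r / 2) (by positivity)).norm.const_mul (2 / r)
  have h3 : (fun t : ℝ => (t : ℂ) * f t * (Real.exp (-r * t) : ℂ)) =
      fun t : ℝ => ((t * Real.exp (-(r / 2) * t) : ℝ) : ℂ) *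
        (f t * (Real.exp (-(r / 2) * t) : ℂ)) := by
    funext t
    have : Real.exp (-r * t) = Real.exp (-(r / 2) * t) * Real.exp (-(r / 2) * t) := by
      rw [← Real.exp_add]; ring_nf
    rw [this]; push_cast; ring
  rw [h3]
  refine Integrable.bdd_mul (hf (r / 2) (by positivity)) (c := 2 / r)
    (by fun_prop) ?_
  refine (ae_restrict_iff' measurableSet_Ioi).mpr (Eventually.of_forall fun t ht => ?_)
  have ht : (0 : ℝ) < t := ht
  rw [Complex.norm_real, Real.norm_of_nonneg (by positivity)]
  have := Real.add_one_le_exp (r / 2 * t)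
  rw [show -(r / 2) * t = -(r / 2 * t) by ring, Real.exp_neg, ← div_eq_mul_inv,
    div_le_iff₀ (Real.exp_pos _)]
  calc t = 2 / r * (r / 2 * t) := by field_simp
    _ ≤ 2 / r * Real.exp (r / 2 * t) := by gcongr; linarith

theorem LaplaceIntegrable.hasDerivAt {f : ℝ → ℂ} (hf : LaplaceIntegrable f) {a : ℂ}
    (ha : 0 < a.re) : HasDerivAt (laplace f) (-laplace (fun t => t * f t) a) a := by
  have hb := (hf.id_mul (a.re / 2) (by positivity)).norm
  have hs : {z : ℂ | a.re / 2 < z.re} ∈ 𝓝 a :=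
    (isOpen_lt continuous_const Complex.continuous_re).mem_nhds (by simp; linarith)
  have key := hasDerivAt_integral_of_dominated_loc_of_deriv_le (μ := volume.restrict (Ioi (0:ℝ)))
    (F := fun (z : ℂ) (t : ℝ) => f t * Complex.exp (-z * t))
    (F' := fun (z : ℂ) (t : ℝ) => -(t * f t * Complex.exp (-z * t)))
    (x₀ := a) hs ?_ (hf.integrable ha) (hf.id_mul.integrable ha).neg.aestronglyMeasurable
    (bound := fun t => ‖(t : ℂ) * f t * (Real.exp (-(a.re / 2) * t) : ℂ)‖) ?_ hb ?_
  · have := key.2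
    rw [integral_neg] at this
    exact this
  · filter_upwards [hs] with z hz
    have hz : a.re / 2 < z.re := hz
    exact (hf.integrable (a := z) (by linarith)).aestronglyMeasurable
  · refine (ae_restrict_iff' measurableSet_Ioi).mpr (Eventually.of_forall fun t ht z hz => ?_)
    have ht : (0 : ℝ) < t := ht
    have hz : a.re / 2 < z.re := hz
    rw [norm_neg, norm_mul, norm_mul, norm_cexp_neg_mul_ofReal, norm_mul, norm_mul,
      Complex.norm_real (Real.exp _), Real.norm_of_nonneg (Real.exp_pos _).le]
    gcongr
  · refine Eventually.of_forall fun t z _ => ?_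
    have h1 : HasDerivAt (fun z : ℂ => -z * (t : ℂ)) (-t) z := by
      simpa using (hasDerivAt_neg z).mul_const (t : ℂ)
    convert! (h1.cexp).const_mul (f t) using 1
    ring

theorem LaplaceIntegrable.add {f g : ℝ → ℂ} (hf : LaplaceIntegrable f)
    (hg : LaplaceIntegrable g) : LaplaceIntegrable (fun t => f t + g t) := by
  intro r hr
  simp only [add_mul]
  exact (hf r hr).add (hg r hr)

theorem LaplaceIntegrable.const_mul {f : ℝ → ℂ} (hf : LaplaceIntegrable f) (c : ℂ) :
    LaplaceIntegrable (fun t => c * f t) := by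
  intro r hr
  simpa only [mul_assoc] using (hf r hr).const_mul c

theorem LaplaceIntegrable.mul_bdd {f g : ℝ → ℂ} (hf : LaplaceIntegrable f)
    (hg : AEStronglyMeasurable g (volume.restrict (Ioi 0))) {C : ℝ}
    (hC : ∀ t, 0 < t → ‖g t‖ ≤ C) : LaplaceIntegrable (fun t => g t * f t) := by
  intro r hr
  simpa only [mul_assoc] using Integrable.bdd_mul (hf r hr) hg
    ((ae_restrict_iff' measurableSet_Ioi).mpr (Eventually.of_forall hC))

theorem laplaceIntegrable_one : LaplaceIntegrable (fun _ => 1) := by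
  intro r hr
  have := integrableOn_exp_mul_Ioi (a := -r) (by linarith) 0
  rw [IntegrableOn] at this
  simpa using this.ofReal (𝕜 := ℂ)

theorem laplace_one {a : ℂ} (ha : 0 < a.re) : laplace (fun _ => 1) a = 1 / a := by
  simp only [laplace, one_mul]
  rw [integral_exp_mul_complex_Ioi (by simpa using ha)]
  simp [neg_div_neg_eq]

theorem laplaceIntegrable_rpow {p : ℝ} (hp : -1 < p) :
    LaplaceIntegrable (fun t => ((t ^ p : ℝ) : ℂ)) := by
  intro r hr
  have := integrableOn_rpow_mul_exp_neg_mul_rpow (s := p) (p := 1) hp zero_lt_one hr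
  rw [IntegrableOn] at this
  simpa using this.ofReal (𝕜 := ℂ)

theorem abs_log_le_rpow_add {t : ℝ} (ht : 0 < t) :
    |Real.log t| ≤ 2 * t ^ (-(1 / 2) : ℝ) + t := by
  rw [abs_le]
  constructor
  · have := Real.log_le_rpow_div (x := t⁻¹) (ε := 1 / 2) (by positivity) (by norm_num)
    rw [Real.log_inv, Real.inv_rpow ht.le, ← Real.rpow_neg ht.le] at this
    linarith
  · have := Real.log_le_sub_one_of_pos ht
    have : (0:ℝ) < t ^ (-(1 / 2) : ℝ) := by positivity
    linarith

theorem laplaceIntegrable_log : LaplaceIntegrable (fun t => (Real.log t : ℂ)) := by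
  intro r hr
  have h := (((laplaceIntegrable_rpow (p := -(1/2)) (by norm_num)).const_mul 2).add
    laplaceIntegrable_one.id_mul) r hr
  refine Integrable.mono h ?_ ?_
  · exact ((Complex.measurable_ofReal.comp Real.measurable_log).mul
      (by fun_prop)).aestronglyMeasurable
  · refine (ae_restrict_iff' measurableSet_Ioi).mpr (Eventually.of_forall fun t ht => ?_)
    have ht : (0 : ℝ) < t := ht
    rw [norm_mul, norm_mul]
    gcongr
    have := abs_log_le_rpow_add ht
    rw [Complex.norm_real, Real.norm_eq_abs]
    refine this.trans (le_of_eq ?_)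
    dsimp only
    rw [show (2 : ℂ) * ((t ^ (-(1 / 2) : ℝ) : ℝ) : ℂ) + t * 1 =
      ((2 * t ^ (-(1 / 2) : ℝ) + t : ℝ) : ℂ) by push_cast; ring, Complex.norm_real,
      Real.norm_of_nonneg (by positivity)]

theorem tendsto_mul_log_mul_cexp_atTop {a : ℂ} (ha : 0 < a.re) :
    Tendsto (fun t : ℝ => (t * Real.log t : ℂ) * Complex.exp (-a * t)) atTop (𝓝 0) := by
  rw [tendsto_zero_iff_norm_tendsto_zero]
  have h := (Real.tendsto_pow_mul_exp_neg_atTop_nhds_zero 2).comp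
    (tendsto_id.const_mul_atTop ha)
  have h' := h.const_mul ((a.re ^ 2)⁻¹)
  rw [mul_zero] at h'
  refine squeeze_zero' (Eventually.of_forall fun _ => norm_nonneg _) ?_ h'
  filter_upwards [eventually_ge_atTop (1 : ℝ)] with t ht
  have hl := Real.log_le_sub_one_of_pos (by linarith : 0 < t)
  have hl0 := Real.log_nonneg ht
  rw [norm_mul, norm_cexp_neg_mul_ofReal, norm_mul, Complex.norm_real, Complex.norm_real,
    Real.norm_of_nonneg hl0, Real.norm_of_nonneg (by linarith)]
  simp only [Function.comp, id]
  rw [show (a.re ^ 2)⁻¹ * ((a.re * t) ^ 2 * Real.exp (-(a.re * t))) =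
    t ^ 2 * Real.exp (-a.re * t) by field_simp]
  gcongr
  nlinarith

/-- Integration by parts: `∫₀^∞ d/dt (t log t e^{-at}) dt = 0`. -/
theorem laplace_log_add_inv {a : ℂ} (ha : 0 < a.re) :
    laplace (fun t => (Real.log t : ℂ)) a + 1 / a
      = a * laplace (fun t => t * (Real.log t : ℂ)) a := by
  have h1 := laplaceIntegrable_log.integrable ha
  have h2 := laplaceIntegrable_log.id_mul.integrable ha
  have h3 := laplaceIntegrable_one.integrable ha
  have key := integral_Ioi_of_hasDerivAt_of_tendsto (a := (0:ℝ)) (m := 0)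
    (f := fun t : ℝ => (t * Real.log t : ℂ) * Complex.exp (-a * t))
    (f' := fun t : ℝ => ((Real.log t : ℂ) * Complex.exp (-a * t) + 1 * Complex.exp (-a * t))
      - a * (t * Real.log t * Complex.exp (-a * t))) ?_ ?_ ((h1.add h3).sub (h2.const_mul a))
    (tendsto_mul_log_mul_cexp_atTop ha)
  · replace key := (integral_sub (h1.add h3) (h2.const_mul a)).symm.trans key
    rw [integral_add' h1 h3, integral_const_mul, integral_const_mul] at key
    rw [← laplace_one ha]
    simp only [laplace, one_mul]
    simp only [Complex.ofReal_zero, zero_mul, sub_zero, one_mul] at key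
    exact sub_eq_zero.mp key
  · have : Continuous fun t : ℝ => (t * Real.log t : ℂ) * Complex.exp (-a * t) := by
      have := Real.continuous_mul_log
      have h : Continuous fun t : ℝ => ((t * Real.log t : ℝ) : ℂ) :=
        Complex.continuous_ofReal.comp this
      simp only [Complex.ofReal_mul] at h
      exact h.mul (by fun_prop)
    exact this.continuousWithinAt
  · intro t ht
    have ht : (0 : ℝ) < t := ht
    have e1 : HasDerivAt (fun t : ℝ => ((t * Real.log t : ℝ) : ℂ)) ((Real.log t + 1 : ℝ) : ℂ) t :=
      (Real.hasDerivAt_mul_log ht.ne').ofReal_comp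
    have e2 : HasDerivAt (fun t : ℝ => -a * (t : ℂ)) (-a) t := by
      simpa using (Complex.ofRealCLM.hasDerivAt (x := t)).const_mul (-a)
    have := e1.mul e2.cexp
    simp only [Complex.ofReal_mul] at this
    refine this.congr_deriv ?_
    push_cast
    ring

theorem laplace_log_at_one :
    laplace (fun t => (Real.log t : ℂ)) 1 = -Real.eulerMascheroniConstant := by
  have h := Complex.hasDerivAt_GammaIntegral (s := 1) (by simp)
  have h2 : HasDerivAt Complex.GammaIntegral (-Real.eulerMascheroniConstant) 1 := by
    refine Complex.hasDerivAt_Gamma_one.congr_of_eventuallyEq ?_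
    filter_upwards [(isOpen_lt continuous_const Complex.continuous_re).mem_nhds
      (show (0 : ℝ) < (1 : ℂ).re by simp)] with s hs
    exact (Complex.Gamma_eq_integral hs).symm
  rw [← h.unique h2]
  simp [laplace]

/-- `∫₀^∞ log t e^{-at} dt = -(γ + log a) / a` on the right half-plane: the function
`a ∫₀^∞ log t e^{-at} dt + log a` has derivative zero, and its value at `1` is `Γ'(1) = -γ`. -/
theorem mul_laplace_log {a : ℂ} (ha : 0 < a.re) :
    a * laplace (fun t => (Real.log t : ℂ)) a
      = -Real.eulerMascheroniConstant - Complex.log a := by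
  set U : Set ℂ := {z | 0 < z.re}
  have hU : IsOpen U := isOpen_lt continuous_const Complex.continuous_re
  have hU' : Convex ℝ U := convex_halfSpace_re_gt 0
  set G : ℂ → ℂ := fun z => z * laplace (fun t => (Real.log t : ℂ)) z + Complex.log z
  have hd : ∀ z ∈ U, HasDerivAt G 0 z := by
    intro z hz
    have hz : 0 < z.re := hz
    have hz0 : z ≠ 0 := fun h => by simp [h] at hz
    have h1 := ((hasDerivAt_id z).mul (laplaceIntegrable_log.hasDerivAt hz)).add
      (Complex.hasDerivAt_log (Or.inl hz))
    refine h1.congr_deriv ?_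
    have := laplace_log_add_inv hz
    simp only [id, one_mul]
    linear_combination this + (one_div z).symm
  have hc : G a = G 1 := by
    refine hU.is_const_of_deriv_eq_zero hU'.isPreconnected
      (fun z hz => (hd z hz).differentiableAt.differentiableWithinAt)
      (fun z hz => (hd z hz).deriv) ha (by simp [U])
  simp only [G, one_mul, Complex.log_one, add_zero, laplace_log_at_one] at hc
  linear_combination hc

/-! ### The Frobenius series of the Bessel equation -/

/-- The sum of a power series with coefficients `c`. -/
noncomputable def powSum (c : ℕ → ℂ) (w : ℂ) : ℂ := ∑' k, c k * w ^ k

/-- Coefficients dominated by those of the exponential series. This class is stable under termwise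
differentiation, and contains the coefficients of both Bessel series. -/
def ExpBounded (c : ℕ → ℂ) : Prop := ∀ k, ‖c k‖ ≤ 1 / (k.factorial : ℝ)

/-- The coefficients of the termwise derivative. -/
def derivCoeff (c : ℕ → ℂ) (k : ℕ) : ℂ := (k + 1 : ℂ) * c (k + 1)

theorem ExpBounded.derivCoeff {c : ℕ → ℂ} (hc : ExpBounded c) : ExpBounded (derivCoeff c) := by
  intro k
  have h := hc (k + 1)
  have hk : (0 : ℝ) < k + 1 := by positivity
  rw [BesselK.derivCoeff, norm_mul, show ‖(k + 1 : ℂ)‖ = k + 1 by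
    rw [show (k + 1 : ℂ) = ((k + 1 : ℝ) : ℂ) by push_cast; rfl, Complex.norm_real,
      Real.norm_of_nonneg hk.le]]
  rw [Nat.factorial_succ] at h
  push_cast at h
  calc (k + 1 : ℝ) * ‖c (k + 1)‖ ≤ (k + 1) * (1 / ((k + 1) * k.factorial)) := by gcongr
    _ = 1 / (k.factorial : ℝ) := by field_simp

theorem ExpBounded.summable {c : ℕ → ℂ} (hc : ExpBounded c) (w : ℂ) :
    Summable fun k => c k * w ^ k := by
  refine Summable.of_norm_bounded (Real.summable_pow_div_factorial ‖w‖) fun k => ?_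
  rw [norm_mul, norm_pow, div_eq_mul_one_div, mul_comm]
  gcongr
  exact hc k

theorem ExpBounded.hasDerivAt {c : ℕ → ℂ} (hc : ExpBounded c) (w : ℂ) :
    HasDerivAt (powSum c) (powSum (BesselK.derivCoeff c) w) w := by
  set r : ℝ := ‖w‖ + 1
  have hu : Summable fun k : ℕ => (r ^ (k - 1) * (k * (1 / (k.factorial : ℝ)))) := by
    rw [← summable_nat_add_iff 1]
    refine (Real.summable_pow_div_factorial r).congr fun k => ?_
    rw [Nat.factorial_succ]
    push_cast
    field_simp
  have key := hasDerivAt_tsum_of_isPreconnected (𝕜 := ℂ) (F := ℂ)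
    (g := fun k z => c k * z ^ k) (g' := fun k z => c k * (k * z ^ (k - 1))) hu
    (Metric.isOpen_ball (x := (0 : ℂ)) (ε := r)) (convex_ball 0 r).isPreconnected
    (fun k z _ => (hasDerivAt_pow k z).const_mul (c k)) ?_
    (y₀ := w) (by simp [r]) (hc.summable w) (y := w) (by simp [r])
  · refine key.congr_deriv ?_
    have hs : Summable fun k : ℕ => c k * (k * w ^ (k - 1)) := by
      rw [← summable_nat_add_iff 1]
      refine (hc.derivCoeff.summable w).congr fun k => ?_
      simp only [BesselK.derivCoeff, Nat.add_sub_cancel]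
      push_cast
      ring
    rw [hs.tsum_eq_zero_add, powSum]
    simp only [Nat.cast_zero, zero_mul, mul_zero, zero_add, Nat.add_sub_cancel]
    refine tsum_congr fun k => ?_
    simp only [BesselK.derivCoeff]
    push_cast
    ring
  · intro k z hz
    rw [Metric.mem_ball, dist_zero_right] at hz
    rw [norm_mul, norm_mul, norm_pow, Complex.norm_natCast]
    calc ‖c k‖ * (k * ‖z‖ ^ (k - 1)) ≤ 1 / (k.factorial : ℝ) * (k * r ^ (k - 1)) := by
          gcongr
          exact hc k
      _ = _ := by ring

theorem powSum_zero (c : ℕ → ℂ) : powSum c 0 = c 0 := by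
  rw [powSum, tsum_eq_single 0]
  · simp
  · intro k hk
    simp [hk]

/-- Comparison of coefficients: `w f'' + f' = g` as soon as `(k + 1)² c_{k+1} = d_k`. -/
theorem ExpBounded.mul_deriv_add {c d : ℕ → ℂ} (hc : ExpBounded c)
    (h : ∀ k : ℕ, (k + 1 : ℂ) ^ 2 * c (k + 1) = d k) (w : ℂ) :
    w * powSum (BesselK.derivCoeff (BesselK.derivCoeff c)) w + powSum (BesselK.derivCoeff c) w
      = powSum d w := by
  have h1 := hc.derivCoeff.summable w
  have h2 := (hc.derivCoeff.derivCoeff.summable w).mul_left w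
  have h3 : HasSum (fun k : ℕ => (k : ℂ) * BesselK.derivCoeff c k * w ^ k)
      (w * powSum (BesselK.derivCoeff (BesselK.derivCoeff c)) w) := by
    rw [powSum, ← tsum_mul_left, ← hasSum_nat_add_iff' 1]
    simp only [Finset.range_one, Finset.sum_singleton, Nat.cast_zero, zero_mul, sub_zero]
    refine h2.hasSum.congr_fun fun k => ?_
    simp only [BesselK.derivCoeff]
    push_cast
    ring
  rw [← h3.tsum_eq, powSum, powSum, ← h3.summable.tsum_add h1]
  refine tsum_congr fun k => ?_
  rw [← h k]
  simp only [BesselK.derivCoeff]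
  ring

/-- Coefficients of `I₀(2√w)`. -/
noncomputable def coeffI (k : ℕ) : ℂ := 1 / (k.factorial : ℂ) ^ 2

/-- Coefficients of the power series that completes the logarithmic term in `K₀(2√w)`. -/
noncomputable def coeffS (k : ℕ) : ℂ := (harmonic k : ℂ) / (k.factorial : ℂ) ^ 2

theorem expBounded_coeffI : ExpBounded coeffI := by
  intro k
  have h1 : (1 : ℝ) ≤ k.factorial := by exact_mod_cast k.factorial_pos
  rw [coeffI, norm_div, norm_pow, Complex.norm_natCast, norm_one]
  gcongr
  nlinarith

theorem harmonic_le_self (k : ℕ) : (harmonic k : ℝ) ≤ k := by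
  induction k with
  | zero => simp
  | succ k ih =>
    rw [harmonic_succ]
    push_cast
    have : ((k : ℝ) + 1)⁻¹ ≤ 1 := inv_le_one_of_one_le₀ (by linarith [k.cast_nonneg (α := ℝ)])
    linarith

theorem harmonic_nonneg (k : ℕ) : (0 : ℝ) ≤ harmonic k := by
  induction k with
  | zero => simp
  | succ k ih =>
    rw [harmonic_succ]
    push_cast
    positivity

theorem expBounded_coeffS : ExpBounded coeffS := by
  intro k
  have h1 : (0 : ℝ) < k.factorial := by exact_mod_cast k.factorial_pos
  have h2 : (k : ℝ) ≤ k.factorial := by exact_mod_cast k.self_le_factorial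
  rw [coeffS, norm_div, norm_pow, Complex.norm_natCast,
    show ((harmonic k : ℚ) : ℂ) = ((harmonic k : ℝ) : ℂ) by push_cast; rfl, Complex.norm_real,
    Real.norm_of_nonneg (harmonic_nonneg k), div_le_div_iff₀ (by positivity) h1]
  nlinarith [harmonic_le_self k]

/-- `I₀(2√w) = ∑ w^k / k!²`. -/
noncomputable def seriesI : ℂ → ℂ := powSum coeffI

/-- `∑ H_k w^k / k!²`. -/
noncomputable def seriesS : ℂ → ℂ := powSum coeffS

theorem seriesI_ode (w : ℂ) :
    w * powSum (derivCoeff (derivCoeff coeffI)) w + powSum (derivCoeff coeffI) w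
      = seriesI w := by
  refine expBounded_coeffI.mul_deriv_add (fun k => ?_) w
  have : (k.factorial : ℂ) ≠ 0 := by exact_mod_cast k.factorial_ne_zero
  have h1 : (k + 1 : ℂ) ≠ 0 := by exact_mod_cast k.succ_ne_zero
  simp only [coeffI, Nat.factorial_succ]
  push_cast
  field_simp

/-- The inhomogeneous term `I'` compensates the derivatives of the logarithm in `besselL`. -/
theorem seriesS_ode (w : ℂ) :
    w * powSum (derivCoeff (derivCoeff coeffS)) w + powSum (derivCoeff coeffS) w
      = seriesS w + powSum (derivCoeff coeffI) w := by
  have h := expBounded_coeffS.mul_deriv_add (d := fun k => coeffS k + derivCoeff coeffI k)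
    (fun k => ?_) w
  · rw [h, seriesS, powSum, powSum, powSum,
      ← (expBounded_coeffS.summable w).tsum_add (expBounded_coeffI.derivCoeff.summable w)]
    exact tsum_congr fun k => by ring
  · have : (k.factorial : ℂ) ≠ 0 := by exact_mod_cast k.factorial_ne_zero
    have h1 : (k + 1 : ℂ) ≠ 0 := by exact_mod_cast k.succ_ne_zero
    simp only [coeffS, coeffI, derivCoeff, Nat.factorial_succ, harmonic_succ]
    push_cast
    field_simp

/-- `2 K₀(2√w)`, as a function of `w` on the slit plane: the sum of the logarithmic series of
Frobenius type. -/
noncomputable def besselL (w : ℂ) : ℂ :=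
  -(Complex.log w + 2 * Real.eulerMascheroniConstant) * seriesI w + 2 * seriesS w

theorem continuous_seriesI : Continuous seriesI :=
  continuous_iff_continuousAt.mpr fun w => (expBounded_coeffI.hasDerivAt w).continuousAt

theorem continuous_seriesS : Continuous seriesS :=
  continuous_iff_continuousAt.mpr fun w => (expBounded_coeffS.hasDerivAt w).continuousAt

/-! ### A singular initial value problem, and integrals with phase `a t + b / t` -/

/-- Uniqueness at the singular point of `τ f'' + f' = w f`, by the energy
`‖f‖² + τ ‖f'‖²`: its logarithmic derivative is bounded by `(1 + ‖w‖)²`, so it vanishes on `(0, ∞)`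
as soon as it tends to zero at `0`. -/
theorem eq_zero_of_singular_ode {D D₁ D₂ : ℝ → ℂ} {w : ℂ}
    (h₁ : ∀ τ, 0 < τ → HasDerivAt D (D₁ τ) τ) (h₂ : ∀ τ, 0 < τ → HasDerivAt D₁ (D₂ τ) τ)
    (hode : ∀ τ : ℝ, 0 < τ → τ * D₂ τ + D₁ τ = w * D τ)
    (h0 : Tendsto D (𝓝[>] 0) (𝓝 0))
    (h0' : Tendsto (fun τ : ℝ => (√τ : ℂ) * D₁ τ) (𝓝[>] 0) (𝓝 0)) {τ : ℝ} (hτ : 0 < τ) :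
    D τ = 0 := by
  set C : ℝ := (1 + ‖w‖) ^ 2
  set En : ℝ → ℝ := fun τ => ‖D τ‖ ^ 2 + τ * ‖D₁ τ‖ ^ 2
  set H : ℝ → ℝ := fun τ => En τ * Real.exp (-C * τ)
  have hE : ∀ τ, 0 < τ → HasDerivAt En (2 * inner ℝ (D τ) (D₁ τ) +
      (1 * ‖D₁ τ‖ ^ 2 + τ * (2 * inner ℝ (D₁ τ) (D₂ τ)))) τ := fun τ hτ =>
    (h₁ τ hτ).norm_sq.add ((hasDerivAt_id τ).mul (h₂ τ hτ).norm_sq)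
  have hH : ∀ τ, 0 < τ → HasDerivAt H ((2 * inner ℝ (D τ) (D₁ τ) +
      (1 * ‖D₁ τ‖ ^ 2 + τ * (2 * inner ℝ (D₁ τ) (D₂ τ)))) * Real.exp (-C * τ) +
        En τ * (Real.exp (-C * τ) * -C)) τ := fun τ hτ => by
    refine ((hE τ hτ).mul ((hasDerivAt_id τ).const_mul (-C)).exp).congr_deriv ?_
    simp
  have hanti : AntitoneOn H (Ioi 0) := by
    refine antitoneOn_of_deriv_nonpos (convex_Ioi 0)
      (fun τ hτ => (hH τ hτ).continuousAt.continuousWithinAt)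
      (fun τ hτ => ?_) (fun τ hτ => ?_)
    · rw [interior_Ioi] at hτ
      exact (hH τ hτ).differentiableAt.differentiableWithinAt
    · rw [interior_Ioi] at hτ
      have hτ : 0 < τ := hτ
      rw [(hH τ hτ).deriv]
      have e1 : τ * (2 * inner ℝ (D₁ τ) (D₂ τ))
          = 2 * inner ℝ (D₁ τ) (w * D τ) - 2 * ‖D₁ τ‖ ^ 2 := by
        rw [← hode τ hτ, inner_add_right, real_inner_self_eq_norm_sq, ← Complex.real_smul,
          real_inner_smul_right]
        ring
      have e2 := real_inner_le_norm (D τ) (D₁ τ)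
      have e3 := real_inner_le_norm (D₁ τ) (w * D τ)
      rw [norm_mul] at e3
      have e4 : 2 * inner ℝ (D τ) (D₁ τ) +
          (1 * ‖D₁ τ‖ ^ 2 + τ * (2 * inner ℝ (D₁ τ) (D₂ τ))) ≤ C * En τ := by
        rw [e1]
        have e5 : 0 ≤ C * (τ * ‖D₁ τ‖ ^ 2) := by positivity
        simp only [En, C] at e5 ⊢
        -- The term `-‖D₁‖²` left over absorbs the mixed term `2 (1 + ‖w‖) ‖D‖ ‖D₁‖`.
        nlinarith [sq_nonneg (‖D₁ τ‖ - (1 + ‖w‖) * ‖D τ‖)]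
      nlinarith [Real.exp_pos (-C * τ)]
  have hlim : Tendsto H (𝓝[>] 0) (𝓝 0) := by
    have e1 : Tendsto (fun τ : ℝ => ‖D τ‖ ^ 2 + ‖(√τ : ℂ) * D₁ τ‖ ^ 2) (𝓝[>] 0) (𝓝 0) := by
      simpa using (h0.norm.pow 2).add (h0'.norm.pow 2)
    have e2 : Tendsto (fun τ : ℝ => Real.exp (-C * τ)) (𝓝[>] 0) (𝓝 1) := by
      have : Continuous fun τ : ℝ => Real.exp (-C * τ) := by fun_prop
      simpa using (this.tendsto 0).mono_left nhdsWithin_le_nhds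
    have e3 := e1.mul e2
    rw [zero_mul] at e3
    refine e3.congr' ?_
    filter_upwards [self_mem_nhdsWithin] with τ hτ
    have hτ : 0 < τ := hτ
    simp only [H, En]
    rw [norm_mul, Complex.norm_real, mul_pow, Real.norm_of_nonneg (Real.sqrt_nonneg τ),
      Real.sq_sqrt hτ.le]
  have hle : H τ ≤ 0 := by
    refine ge_of_tendsto hlim ?_
    filter_upwards [Ioo_mem_nhdsGT hτ] with σ hσ
    exact hanti hσ.1 hτ hσ.2.le
  have h4 : En τ ≤ 0 := by
    by_contra h
    exact absurd hle (not_le.mpr (mul_pos (not_le.mp h) (Real.exp_pos _)))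
  have h5 : ‖D τ‖ ^ 2 ≤ 0 := by
    have : 0 ≤ τ * ‖D₁ τ‖ ^ 2 := by positivity
    simp only [En] at h4
    linarith
  simpa using h5

theorem norm_cexp_neg_div_le_one {b : ℂ} (hb : 0 ≤ b.re) {t : ℝ} (ht : 0 < t) :
    ‖Complex.exp (-b / t)‖ ≤ 1 := by
  rw [Complex.norm_exp, Complex.div_ofReal_re, Complex.neg_re, Real.exp_le_one_iff, neg_div,
    neg_nonpos]
  positivity

theorem norm_cexp_neg_div_le {b : ℂ} (hb : 0 < b.re) {t : ℝ} (ht : 0 < t) :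
    ‖Complex.exp (-b / t)‖ ≤ t / b.re := by
  rw [Complex.norm_exp, Complex.div_ofReal_re, Complex.neg_re, neg_div, Real.exp_neg,
    inv_le_comm₀ (Real.exp_pos _) (by positivity), inv_div]
  linarith [Real.add_one_le_exp (b.re / t)]

theorem norm_cexp_neg_div_le_sq {b : ℂ} (hb : 0 < b.re) {t : ℝ} (ht : 0 < t) :
    ‖Complex.exp (-b / t)‖ ≤ 2 * t ^ 2 / b.re ^ 2 := by
  rw [Complex.norm_exp, Complex.div_ofReal_re, Complex.neg_re, neg_div, Real.exp_neg,
    inv_le_comm₀ (Real.exp_pos _) (by positivity), inv_div]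
  have := Real.pow_div_factorial_le_exp (b.re / t) (by positivity) 2
  refine le_trans (le_of_eq ?_) this
  simp [div_pow]
  field_simp

/-- `M(a, b) = ∫₀^∞ e^{-at - b/t} dt/t`, which converges absolutely if `a` and `b` have positive real
parts. -/
noncomputable def besselM (a b : ℂ) : ℂ := laplace (fun t => Complex.exp (-b / t) / t) a

theorem laplace_congr {f g : ℝ → ℂ} (h : ∀ t, 0 < t → f t = g t) (a : ℂ) :
    laplace f a = laplace g a :=
  setIntegral_congr_fun measurableSet_Ioi fun t ht => by simp only [h t ht]

theorem laplaceIntegrable_expK {b : ℂ} (hb : 0 ≤ b.re) :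
    LaplaceIntegrable (fun t => Complex.exp (-b / t)) := by
  have := laplaceIntegrable_one.mul_bdd (g := fun t : ℝ => Complex.exp (-b / t)) (C := 1)
    (Measurable.aestronglyMeasurable (by fun_prop)) (fun t ht => norm_cexp_neg_div_le_one hb ht)
  simpa using this

theorem laplaceIntegrable_kernM {b : ℂ} (hb : 0 < b.re) :
    LaplaceIntegrable (fun t => Complex.exp (-b / t) / t) := by
  have := laplaceIntegrable_one.mul_bdd (g := fun t : ℝ => Complex.exp (-b / t) / t)
    (C := 1 / b.re) (Measurable.aestronglyMeasurable (by fun_prop)) (fun t ht => ?_)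
  · simpa using this
  · rw [norm_div, Complex.norm_real, Real.norm_of_nonneg ht.le, div_le_iff₀ ht]
    exact (norm_cexp_neg_div_le hb ht).trans (le_of_eq (by ring))

theorem laplaceIntegrable_log_mul {b : ℂ} (hb : 0 ≤ b.re) :
    LaplaceIntegrable (fun t => Complex.exp (-b / t) * Real.log t) :=
  laplaceIntegrable_log.mul_bdd (C := 1) (Measurable.aestronglyMeasurable (by fun_prop))
    (fun _ ht => norm_cexp_neg_div_le_one hb ht)

theorem laplaceIntegrable_log_div_sq {b : ℂ} (hb : 0 < b.re) :
    LaplaceIntegrable (fun t => Complex.exp (-b / t) / t ^ 2 * Real.log t) :=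
  laplaceIntegrable_log.mul_bdd (C := 2 / b.re ^ 2)
    (Measurable.aestronglyMeasurable (by fun_prop)) (fun t ht => by
    rw [norm_div, norm_pow, Complex.norm_real, Real.norm_of_nonneg ht.le,
      div_le_iff₀ (by positivity)]
    exact (norm_cexp_neg_div_le_sq hb ht).trans (le_of_eq (by ring)))

/-- The derivative of `e^{-at - b/t}`. -/
theorem hasDerivAt_phase (a b : ℂ) {t : ℝ} (ht : 0 < t) :
    HasDerivAt (fun t : ℝ => Complex.exp (-b / t) * Complex.exp (-a * t))
      ((b / t ^ 2 - a) * (Complex.exp (-b / t) * Complex.exp (-a * t))) t := by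
  have h0 : (t : ℂ) ≠ 0 := by exact_mod_cast ht.ne'
  have e1 : HasDerivAt (fun z : ℂ => Complex.exp (-b / z) * Complex.exp (-a * z))
      ((b / t ^ 2 - a) * (Complex.exp (-b / t) * Complex.exp (-a * t))) (t : ℂ) := by
    have d1 : HasDerivAt (fun z : ℂ => -b / z) (b / t ^ 2) (t : ℂ) := by
      have := (hasDerivAt_const (t : ℂ) (-b)).div (hasDerivAt_id (t : ℂ)) h0
      refine this.congr_deriv ?_
      simp
    have d2 : HasDerivAt (fun z : ℂ => -a * z) (-a) (t : ℂ) := by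
      simpa using (hasDerivAt_id (t : ℂ)).const_mul (-a)
    refine (d1.cexp.mul d2.cexp).congr_deriv ?_
    ring
  exact e1.comp_ofReal

/-- Integration by parts: `∫₀^∞ d/dt (t e^{-at - b/t}) dt = 0`. -/
theorem laplace_expK_relation {a b : ℂ} (ha : 0 < a.re) (hb : 0 < b.re) :
    laplace (fun t => Complex.exp (-b / t)) a + b * besselM a b
      = a * laplace (fun t => t * Complex.exp (-b / t)) a := by
  have h1 := (laplaceIntegrable_expK hb.le).integrable ha
  have h2 := (laplaceIntegrable_expK hb.le).id_mul.integrable ha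
  have h3 := (laplaceIntegrable_kernM hb).integrable ha
  have key := integral_Ioi_of_hasDerivAt_of_tendsto (a := (0:ℝ)) (m := 0)
    (f := fun t : ℝ => (t : ℂ) * (Complex.exp (-b / t) * Complex.exp (-a * t)))
    (f' := fun t : ℝ => (Complex.exp (-b / t) * Complex.exp (-a * t)
        + b * (Complex.exp (-b / t) / t * Complex.exp (-a * t)))
      - a * (t * Complex.exp (-b / t) * Complex.exp (-a * t))) ?_ ?_
      ((h1.add (h3.const_mul b)).sub (h2.const_mul a)) ?_
  · replace key := (integral_sub (h1.add (h3.const_mul b)) (h2.const_mul a)).symm.trans key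
    rw [integral_add' h1 (h3.const_mul b), integral_const_mul, integral_const_mul] at key
    simp only [Complex.ofReal_zero, zero_mul, sub_zero] at key
    exact sub_eq_zero.mp key
  · rw [← continuousWithinAt_Ioi_iff_Ici, ContinuousWithinAt]
    simp only [Complex.ofReal_zero, zero_mul]
    rw [tendsto_zero_iff_norm_tendsto_zero]
    have hid : Tendsto (fun t : ℝ => t) (𝓝[>] 0) (𝓝 0) := nhdsWithin_le_nhds
    refine squeeze_zero' (Eventually.of_forall fun _ => norm_nonneg _) ?_ hid
    filter_upwards [self_mem_nhdsWithin] with t ht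
    have ht : 0 < t := ht
    rw [norm_mul, norm_mul, norm_cexp_neg_mul_ofReal, Complex.norm_real, Real.norm_of_nonneg ht.le]
    have e1 := norm_cexp_neg_div_le_one hb.le ht
    have e2 : Real.exp (-a.re * t) ≤ 1 := Real.exp_le_one_iff.mpr (by nlinarith)
    have : ‖Complex.exp (-b / t)‖ * Real.exp (-a.re * t) ≤ 1 :=
      mul_le_one₀ e1 (Real.exp_pos _).le e2
    nlinarith
  · intro t ht
    have ht : (0 : ℝ) < t := ht
    have h0 : (t : ℂ) ≠ 0 := by exact_mod_cast ht.ne'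
    refine ((Complex.ofRealCLM.hasDerivAt (x := t)).mul
      (hasDerivAt_phase a b ht)).congr_deriv ?_
    simp only [Complex.ofRealCLM_apply, Complex.ofReal_one]
    field_simp
    ring
  · rw [tendsto_zero_iff_norm_tendsto_zero]
    have h := ((Real.tendsto_pow_mul_exp_neg_atTop_nhds_zero 1).comp
      (tendsto_id.const_mul_atTop ha)).const_mul (a.re⁻¹)
    rw [mul_zero] at h
    refine squeeze_zero' (Eventually.of_forall fun _ => norm_nonneg _) ?_ h
    filter_upwards [eventually_gt_atTop (0 : ℝ)] with t ht
    rw [norm_mul, norm_mul, norm_cexp_neg_mul_ofReal, Complex.norm_real, Real.norm_of_nonneg ht.le]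
    have e1 := norm_cexp_neg_div_le_one hb.le ht
    simp only [Function.comp, id, pow_one]
    rw [show a.re⁻¹ * (a.re * t * Real.exp (-(a.re * t))) = t * (1 * Real.exp (-a.re * t)) by
      field_simp]
    gcongr

/-- Substitution `t ↦ 1/t`. -/
theorem integral_Ioi_inv (g : ℝ → ℂ) :
    ∫ t in Ioi (0 : ℝ), g t⁻¹ / t ^ 2 = ∫ t in Ioi (0 : ℝ), g t := by
  rw [← integral_comp_rpow_Ioi g (p := -1) (by norm_num)]
  refine setIntegral_congr_fun measurableSet_Ioi fun t ht => ?_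
  have ht : (0 : ℝ) < t := ht
  simp only [Real.rpow_neg_one, abs_neg, abs_one, one_mul, Complex.real_smul]
  rw [show (-1 - 1 : ℝ) = -(2 : ℕ) by norm_num, Real.rpow_neg ht.le, Real.rpow_natCast]
  push_cast
  ring

/-- Integration by parts against the logarithm; the substitution `t ↦ 1/t` makes the two terms
symmetric. -/
theorem besselM_eq_laplace_log {a b : ℂ} (ha : 0 < a.re) (hb : 0 < b.re) :
    besselM a b = a * laplace (fun t => Complex.exp (-b / t) * Real.log t) a
      + b * laplace (fun t => Complex.exp (-a / t) * Real.log t) b := by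
  have h1 := (laplaceIntegrable_kernM hb).integrable ha
  have h2 := (laplaceIntegrable_log_mul hb.le).integrable ha
  have h3 := (laplaceIntegrable_log_div_sq hb).integrable ha
  have hinv : ∫ t in Ioi (0 : ℝ), Complex.exp (-b / t) / t ^ 2 * Real.log t * Complex.exp (-a * t)
      = - laplace (fun t => Complex.exp (-a / t) * Real.log t) b := by
    rw [laplace, ← integral_Ioi_inv, ← integral_neg]
    refine setIntegral_congr_fun measurableSet_Ioi fun t ht => ?_
    have h0 : (t : ℂ) ≠ 0 := by exact_mod_cast (ne_of_gt ht)
    simp only [Real.log_inv, Complex.ofReal_inv, Complex.ofReal_neg, div_inv_eq_mul]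
    rw [show -a * (t : ℂ)⁻¹ = -a / t by ring]
    field_simp
  have hint : Integrable (fun t : ℝ => (Complex.exp (-b / t) / t * Complex.exp (-a * t)
        + b * (Complex.exp (-b / t) / t ^ 2 * Real.log t * Complex.exp (-a * t)))
      - a * (Complex.exp (-b / t) * Real.log t * Complex.exp (-a * t)))
      (volume.restrict (Ioi 0)) := (h1.add (h3.const_mul b)).sub (h2.const_mul a)
  have key := integral_Ioi_of_hasDerivAt_of_tendsto (a := (0:ℝ)) (m := 0)
    (f := fun t : ℝ => (Real.log t : ℂ) * (Complex.exp (-b / t) * Complex.exp (-a * t)))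
    (f' := fun t : ℝ => (Complex.exp (-b / t) / t * Complex.exp (-a * t)
        + b * (Complex.exp (-b / t) / t ^ 2 * Real.log t * Complex.exp (-a * t)))
      - a * (Complex.exp (-b / t) * Real.log t * Complex.exp (-a * t))) ?_ ?_
      hint ?_
  · replace key := (integral_sub (h1.add (h3.const_mul b)) (h2.const_mul a)).symm.trans key
    rw [integral_add' h1 (h3.const_mul b), integral_const_mul, integral_const_mul, hinv] at key
    simp only [Real.log_zero, Complex.ofReal_zero, zero_mul, sub_zero] at key
    change besselM a b + _ - a * laplace _ a = 0 at key
    linear_combination key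
  · rw [← continuousWithinAt_Ioi_iff_Ici, ContinuousWithinAt]
    simp only [Real.log_zero, Complex.ofReal_zero, zero_mul]
    rw [tendsto_zero_iff_norm_tendsto_zero]
    have hid : Tendsto (fun t : ℝ => ‖t * Real.log t‖ / b.re) (𝓝[>] 0) (𝓝 0) := by
      have := ((Real.continuous_mul_log.tendsto 0).mono_left
        (nhdsWithin_le_nhds (s := Ioi 0))).norm.div_const b.re
      simpa using this
    refine squeeze_zero' (Eventually.of_forall fun _ => norm_nonneg _) ?_ hid
    filter_upwards [self_mem_nhdsWithin] with t ht
    have ht : 0 < t := ht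
    rw [norm_mul, norm_mul, norm_cexp_neg_mul_ofReal, Complex.norm_real, norm_mul,
      Real.norm_of_nonneg ht.le]
    have e1 := norm_cexp_neg_div_le hb ht
    have e2 : Real.exp (-a.re * t) ≤ 1 := Real.exp_le_one_iff.mpr (by nlinarith)
    calc ‖Real.log t‖ * (‖Complex.exp (-b / t)‖ * Real.exp (-a.re * t))
        ≤ ‖Real.log t‖ * (t / b.re * 1) := by gcongr
      _ = _ := by ring
  · intro t ht
    have ht : (0 : ℝ) < t := ht
    have h0 : (t : ℂ) ≠ 0 := by exact_mod_cast ht.ne'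
    refine ((Real.hasDerivAt_log ht.ne').ofReal_comp.mul
      (hasDerivAt_phase a b ht)).congr_deriv ?_
    push_cast
    field_simp
    ring
  · have h := tendsto_mul_log_mul_cexp_atTop ha
    rw [tendsto_zero_iff_norm_tendsto_zero] at h ⊢
    refine squeeze_zero' (Eventually.of_forall fun _ => norm_nonneg _) ?_ h
    filter_upwards [eventually_gt_atTop (1 : ℝ)] with t ht
    have e1 := norm_cexp_neg_div_le_one hb.le (by linarith : 0 < t)
    rw [norm_mul, norm_mul, norm_mul, norm_mul, Complex.norm_real t, Real.norm_of_nonneg (by linarith)]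
    calc ‖(Real.log t : ℂ)‖ * (‖Complex.exp (-b / t)‖ * ‖Complex.exp (-a * t)‖)
        ≤ ‖(Real.log t : ℂ)‖ * (1 * ‖Complex.exp (-a * t)‖) := by gcongr
      _ ≤ t * ‖(Real.log t : ℂ)‖ * ‖Complex.exp (-a * t)‖ := by
        rw [one_mul]
        gcongr
        nlinarith [norm_nonneg (Real.log t : ℂ)]

/-- Substitution `u = τ t` in a Laplace transform. -/
theorem mul_laplace_scale (f : ℝ → ℂ) (a : ℂ) {τ : ℝ} (hτ : 0 < τ) :
    τ * laplace (fun t => f (τ * t)) (τ * a) = laplace f a := by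
  have h := integral_comp_mul_left_Ioi' (fun t : ℝ => f t * Complex.exp (-a * t)) 0 hτ
  rw [mul_zero, Complex.real_smul] at h
  rw [laplace, laplace, ← h]
  congr 1
  refine setIntegral_congr_fun measurableSet_Ioi fun t _ => ?_
  congr 2
  push_cast
  ring

theorem besselM_scale (a b : ℂ) {τ : ℝ} (hτ : 0 < τ) :
    besselM (τ * a) b = besselM a (τ * b) := by
  have h0 : (τ : ℂ) ≠ 0 := by exact_mod_cast hτ.ne'
  rw [besselM, besselM, ← mul_laplace_scale _ a hτ, laplace, laplace, ← integral_const_mul]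
  refine setIntegral_congr_fun measurableSet_Ioi fun t ht => ?_
  have h1 : (t : ℂ) ≠ 0 := by exact_mod_cast (ne_of_gt ht)
  push_cast
  rw [show -(τ * b) / (τ * t) = -b / t by field_simp]
  field_simp

theorem mul_laplace_expK_scale (a b : ℂ) {τ : ℝ} (hτ : 0 < τ) :
    τ * laplace (fun t => Complex.exp (-b / t)) (τ * a)
      = laplace (fun t => Complex.exp (-(τ * b) / t)) a := by
  have h0 : (τ : ℂ) ≠ 0 := by exact_mod_cast hτ.ne'
  rw [← mul_laplace_scale _ a hτ]
  congr 1
  refine laplace_congr (fun t ht => ?_) _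
  have h1 : (t : ℂ) ≠ 0 := by exact_mod_cast (ne_of_gt ht)
  push_cast
  rw [show -(τ * b) / (τ * t) = -b / t by field_simp]

/-- The substitution `u = τ t` moves the parameter from the frequency to the phase `b/t`, at the price of
a term `log τ`. -/
theorem mul_laplace_log_scale {a b : ℂ} (ha : 0 < a.re) (hb : 0 ≤ b.re) {τ : ℝ} (hτ : 0 < τ) :
    τ * laplace (fun t => Complex.exp (-b / t) * Real.log t) (τ * a)
      = laplace (fun t => Complex.exp (-(τ * b) / t) * Real.log t) a
        - Real.log τ * laplace (fun t => Complex.exp (-(τ * b) / t)) a := by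
  have h0 : (τ : ℂ) ≠ 0 := by exact_mod_cast hτ.ne'
  have hb' : 0 ≤ ((τ : ℂ) * b).re := by
    rw [Complex.re_ofReal_mul]; positivity
  have h1 := (laplaceIntegrable_log_mul hb').integrable ha
  have h2 := ((laplaceIntegrable_expK hb').integrable ha).const_mul (Real.log τ : ℂ)
  simp only [laplace]
  rw [← integral_const_mul (Real.log τ : ℂ), ← integral_sub h1 h2]
  have h3 := mul_laplace_scale
    (fun t => Complex.exp (-(τ * b) / t) * Real.log t - Real.log τ * Complex.exp (-(τ * b) / t))
    a hτ
  have h4 : ∀ f : ℝ → ℂ, laplace f a = ∫ t in Ioi (0 : ℝ), f t * Complex.exp (-a * t) :=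
    fun _ => rfl
  rw [h4] at h3
  simp only [sub_mul, mul_assoc] at h3 ⊢
  rw [← h3]
  congr 1
  simp only [← mul_assoc]
  refine setIntegral_congr_fun measurableSet_Ioi fun t ht => ?_
  have ht' : (0 : ℝ) < t := ht
  have h1 : (t : ℂ) ≠ 0 := by exact_mod_cast (ne_of_gt ht)
  simp only
  rw [Real.log_mul hτ.ne' ht'.ne']
  push_cast
  rw [show -(τ * b) / (τ * t) = -b / t by field_simp]
  ring

/-- Any exponent in `(1/2, 1)` would do: `τ^{3/4}` beats the factors `log τ` and `τ^{-1/2}` met at the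
singular point, and `t^{-3/4}` is integrable at `0`. -/
theorem norm_one_sub_cexp_neg_le {z : ℂ} (hz : 0 ≤ z.re) :
    ‖1 - Complex.exp (-z)‖ ≤ 2 * ‖z‖ ^ (3 / 4 : ℝ) := by
  rcases le_or_gt ‖z‖ 1 with h | h
  · have e1 := Complex.norm_exp_sub_one_le (x := -z) (by simpa using h)
    rw [norm_sub_rev]
    rw [norm_neg] at e1
    refine e1.trans ?_
    gcongr
    have := Real.rpow_le_rpow_of_exponent_ge' (norm_nonneg z) h (z := 3 / 4) (y := 1)
      (by norm_num) (by norm_num)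
    simpa using this
  · have e1 : ‖Complex.exp (-z)‖ ≤ 1 := by
      rw [Complex.norm_exp, Complex.neg_re, Real.exp_le_one_iff]; linarith
    have e2 : 1 ≤ ‖z‖ ^ (3 / 4 : ℝ) := Real.one_le_rpow h.le (by norm_num)
    calc ‖1 - Complex.exp (-z)‖ ≤ ‖(1 : ℂ)‖ + ‖Complex.exp (-z)‖ := norm_sub_le _ _
      _ ≤ 2 * ‖z‖ ^ (3 / 4 : ℝ) := by rw [norm_one]; linarith

theorem exists_norm_one_sub_mul_laplace_expK_le {a b : ℂ} (ha : 0 < a.re) (hb : 0 ≤ b.re) :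
    ∃ C : ℝ, ∀ τ : ℝ, 0 < τ →
      ‖1 - a * laplace (fun t => Complex.exp (-(τ * b) / t)) a‖ ≤ C * τ ^ (3 / 4 : ℝ) := by
  have ha0 : a ≠ 0 := fun h => by simp [h] at ha
  have hint := (laplaceIntegrable_rpow (p := -(3 / 4)) (by norm_num)) a.re ha
  refine ⟨‖a‖ * (2 * ‖b‖ ^ (3 / 4 : ℝ) *
    ∫ t in Ioi (0 : ℝ), ‖((t ^ (-(3 / 4) : ℝ) : ℝ) : ℂ) * (Real.exp (-a.re * t) : ℂ)‖),
    fun τ hτ => ?_⟩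
  have hb' : 0 ≤ ((τ : ℂ) * b).re := by
    rw [Complex.re_ofReal_mul]; positivity
  have h1 := laplaceIntegrable_one.integrable ha
  have h2 := (laplaceIntegrable_expK hb').integrable ha
  have e : 1 - a * laplace (fun t => Complex.exp (-(τ * b) / t)) a
      = a * ∫ t in Ioi (0 : ℝ), (1 - Complex.exp (-(τ * b) / t)) * Complex.exp (-a * t) := by
    simp only [sub_mul]
    rw [integral_sub h1 h2, mul_sub]
    congr 1
    have := laplace_one ha
    rw [laplace] at this
    rw [this, mul_one_div_cancel ha0]
  rw [e, norm_mul, mul_assoc]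
  gcongr
  rw [mul_right_comm, ← integral_const_mul]
  refine norm_integral_le_of_norm_le (hint.norm.const_mul _) ?_
  refine (ae_restrict_iff' measurableSet_Ioi).mpr (Eventually.of_forall fun t ht => ?_)
  have ht : (0 : ℝ) < t := ht
  have e3 := norm_one_sub_cexp_neg_le (z := τ * b / t) (by
    rw [Complex.div_ofReal_re]; positivity)
  rw [← neg_div] at e3
  rw [norm_mul, norm_mul, Complex.norm_real, Complex.norm_real, norm_cexp_neg_mul_ofReal,
    Real.norm_of_nonneg (Real.exp_pos _).le, Real.norm_of_nonneg (by positivity), ← mul_assoc]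
  gcongr
  refine e3.trans (le_of_eq ?_)
  rw [norm_div, norm_mul, Complex.norm_real, Complex.norm_real, Real.norm_of_nonneg hτ.le,
    Real.norm_of_nonneg ht.le, Real.div_rpow (by positivity) ht.le, Real.mul_rpow hτ.le
    (norm_nonneg _), Real.rpow_neg ht.le]
  ring

theorem tendsto_laplace_log_mul {a b : ℂ} (ha : 0 < a.re) (hb : 0 ≤ b.re) :
    Tendsto (fun τ : ℝ => laplace (fun t => Complex.exp (-(τ * b) / t) * Real.log t) a)
      (𝓝[>] 0) (𝓝 (laplace (fun t => (Real.log t : ℂ)) a)) := by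
  refine tendsto_integral_filter_of_dominated_convergence
    (fun t : ℝ => ‖(Real.log t : ℂ) * Complex.exp (-a * t)‖) ?_ ?_
    (laplaceIntegrable_log.integrable ha).norm ?_
  · exact Eventually.of_forall fun τ => Measurable.aestronglyMeasurable (by fun_prop)
  · filter_upwards [self_mem_nhdsWithin] with τ hτ
    refine (ae_restrict_iff' measurableSet_Ioi).mpr (Eventually.of_forall fun t ht => ?_)
    have hτ : 0 < τ := hτ
    have hb' : 0 ≤ ((τ : ℂ) * b).re := by
      rw [Complex.re_ofReal_mul]; positivity
    rw [mul_assoc, norm_mul]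
    exact mul_le_of_le_one_left (norm_nonneg _) (norm_cexp_neg_div_le_one hb' ht)
  · refine Eventually.of_forall fun t => ?_
    have : Continuous fun τ : ℝ =>
      Complex.exp (-(τ * b) / t) * Real.log t * Complex.exp (-a * t) := by fun_prop
    simpa using (this.tendsto 0).mono_left nhdsWithin_le_nhds

/-! ### The integral as a Bessel function -/

theorem re_ofReal_mul_pos {a : ℂ} (ha : 0 < a.re) {τ : ℝ} (hτ : 0 < τ) :
    0 < ((τ : ℂ) * a).re := by
  rw [Complex.re_ofReal_mul]; positivity

theorem log_mul_of_re_pos {a b : ℂ} (ha : 0 < a.re) (hb : 0 < b.re) :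
    Complex.log (a * b) = Complex.log a + Complex.log b := by
  have h1 := abs_lt.mp (Complex.abs_arg_lt_pi_div_two_iff.mpr (Or.inl ha))
  have h2 := abs_lt.mp (Complex.abs_arg_lt_pi_div_two_iff.mpr (Or.inl hb))
  refine Complex.log_mul (fun h => by simp [h] at ha) (fun h => by simp [h] at hb) ⟨?_, ?_⟩ <;>
    linarith [h1.1, h1.2, h2.1, h2.2]

theorem tendsto_log_add_mul_rpow (κ : ℂ) {r : ℝ} (hr : 0 < r) :
    Tendsto (fun τ : ℝ => ((Real.log τ : ℂ) + κ) * ((τ ^ r : ℝ) : ℂ)) (𝓝[>] 0) (𝓝 0) := by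
  have h1 : Tendsto (fun τ : ℝ => ((Real.log τ * τ ^ r : ℝ) : ℂ)) (𝓝[>] 0) (𝓝 ((0 : ℝ) : ℂ)) :=
    (Complex.continuous_ofReal.tendsto _).comp (tendsto_log_mul_rpow_nhdsGT_zero hr)
  have h2 : Tendsto (fun τ : ℝ => ((τ ^ r : ℝ) : ℂ)) (𝓝[>] 0) (𝓝 ((0 : ℝ) : ℂ)) := by
    have := (Real.continuousAt_rpow_const 0 r (Or.inr hr.le)).tendsto
    rw [Real.zero_rpow hr.ne'] at this
    exact (Complex.continuous_ofReal.tendsto _).comp (this.mono_left nhdsWithin_le_nhds)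
  have := h1.add (h2.const_mul κ)
  simp only [Complex.ofReal_zero, mul_zero, add_zero] at this
  refine this.congr fun τ => ?_
  push_cast
  ring

/-- The logarithmic singularity `∫₀^∞ e^{-τat - b/t} dt/t = -log τ - log a - log b - 2γ + o(1)`. -/
theorem tendsto_besselM_add_log {a b : ℂ} (ha : 0 < a.re) (hb : 0 < b.re) :
    Tendsto (fun τ : ℝ => besselM (τ * a) b + Real.log τ) (𝓝[>] 0)
      (𝓝 (-(Complex.log a + Complex.log b + 2 * Real.eulerMascheroniConstant))) := by
  have h1 := (tendsto_laplace_log_mul ha hb.le).const_mul a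
  have h2 := (tendsto_laplace_log_mul hb ha.le).const_mul b
  rw [mul_laplace_log ha] at h1
  rw [mul_laplace_log hb] at h2
  have h3 : Tendsto (fun τ : ℝ => (Real.log τ : ℂ) *
      (1 - b * laplace (fun t => Complex.exp (-(τ * a) / t)) b)) (𝓝[>] 0) (𝓝 0) := by
    obtain ⟨C, hC⟩ := exists_norm_one_sub_mul_laplace_expK_le hb ha.le
    have h := (tendsto_log_add_mul_rpow 0 (r := 3 / 4) (by norm_num)).norm.const_mul C
    rw [norm_zero, mul_zero] at h
    refine squeeze_zero_norm' ?_ h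
    filter_upwards [self_mem_nhdsWithin] with τ hτ
    have hτ : 0 < τ := hτ
    rw [norm_mul, norm_mul, add_zero, Complex.norm_real (τ ^ _),
      Real.norm_of_nonneg (Real.rpow_nonneg hτ.le _)]
    calc _ ≤ ‖(Real.log τ : ℂ)‖ * (C * τ ^ (3 / 4 : ℝ)) := by gcongr; exact hC τ hτ
      _ = _ := by ring
  have h := (h1.add h2).add h3
  refine (h.congr' ?_).trans (le_of_eq ?_)
  · filter_upwards [self_mem_nhdsWithin] with τ hτ
    have hτ : 0 < τ := hτ
    rw [besselM_scale a b hτ, besselM_eq_laplace_log ha (re_ofReal_mul_pos hb hτ)]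
    linear_combination (-b) * mul_laplace_log_scale hb ha.le hτ
  · congr 1
    ring

theorem hasDerivAt_laplace_ray {f : ℝ → ℂ} (hf : LaplaceIntegrable f) {a : ℂ} (ha : 0 < a.re)
    {τ : ℝ} (hτ : 0 < τ) :
    HasDerivAt (fun τ : ℝ => laplace f (τ * a)) (-a * laplace (fun t => t * f t) (τ * a)) τ := by
  have h1 : HasDerivAt (fun z : ℂ => z * a) a (τ : ℂ) := by
    simpa using (hasDerivAt_id (τ : ℂ)).mul_const a
  have h2 := (HasDerivAt.comp (τ : ℂ) (hf.hasDerivAt (re_ofReal_mul_pos ha hτ)) h1).comp_ofReal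
  refine h2.congr_deriv ?_
  ring

theorem hasDerivAt_powSum_ray {c : ℕ → ℂ} (hc : ExpBounded c) (w : ℂ) (τ : ℝ) :
    HasDerivAt (fun τ : ℝ => powSum c (τ * w)) (w * powSum (derivCoeff c) (τ * w)) τ := by
  have h1 : HasDerivAt (fun z : ℂ => z * w) w (τ : ℂ) := by
    simpa using (hasDerivAt_id (τ : ℂ)).mul_const w
  refine (HasDerivAt.comp (τ : ℂ) (hc.hasDerivAt (τ * w)) h1).comp_ofReal.congr_deriv ?_
  ring

theorem tendsto_powSum_ray {c : ℕ → ℂ} (hc : ExpBounded c) (w : ℂ) :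
    Tendsto (fun τ : ℝ => powSum c (τ * w)) (𝓝[>] 0) (𝓝 (c 0)) := by
  have := (hasDerivAt_powSum_ray hc w 0).continuousAt.tendsto
  rw [Complex.ofReal_zero, zero_mul, powSum_zero] at this
  exact this.mono_left nhdsWithin_le_nhds

theorem tendsto_seriesI_sub_one_div (w : ℂ) :
    Tendsto (fun τ : ℝ => (seriesI (τ * w) - 1) / τ) (𝓝[>] 0) (𝓝 (w * derivCoeff coeffI 0)) := by
  have h := (hasDerivAt_powSum_ray expBounded_coeffI w 0).tendsto_slope_zero_right
  rw [Complex.ofReal_zero, zero_mul, powSum_zero, powSum_zero] at h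
  refine h.congr fun τ => ?_
  rw [zero_add, Complex.real_smul, Complex.ofReal_inv, seriesI, show coeffI 0 = 1 by simp [coeffI]]
  ring

/-- `∫₀^∞ e^{-at - b/t} dt/t = 2 K₀(2√(ab))`: along the ray `τ ↦ τ a` both sides solve the same
Bessel equation, and they have the same logarithmic singularity at `τ = 0`. -/
theorem besselM_eq_besselL {a b : ℂ} (ha : 0 < a.re) (hb : 0 < b.re) :
    besselM a b = besselL (a * b) := by
  set w := a * b with hw
  set κ : ℂ := Complex.log a + Complex.log b + 2 * Real.eulerMascheroniConstant with hκ
  set I₁ := powSum (derivCoeff coeffI)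
  set I₂ := powSum (derivCoeff (derivCoeff coeffI))
  set S₁ := powSum (derivCoeff coeffS)
  set S₂ := powSum (derivCoeff (derivCoeff coeffS))
  set P₀ : ℂ → ℂ := laplace (fun t => Complex.exp (-b / t)) with hP₀
  set P₁ : ℂ → ℂ := laplace (fun t => t * Complex.exp (-b / t)) with hP₁
  set l : ℝ → ℂ := fun τ => (Real.log τ : ℂ) + κ with hl
  have hlog : ∀ τ : ℝ, 0 < τ → HasDerivAt l ((τ : ℂ)⁻¹) τ := fun τ hτ => by
    have := (Real.hasDerivAt_log hτ.ne').ofReal_comp.add_const κ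
    exact this.congr_deriv (by simp)
  have hI : ∀ τ : ℝ, HasDerivAt (fun τ : ℝ => seriesI (τ * w)) (w * I₁ (τ * w)) τ :=
    hasDerivAt_powSum_ray expBounded_coeffI w
  have hI₁ : ∀ τ : ℝ, HasDerivAt (fun τ : ℝ => I₁ (τ * w)) (w * I₂ (τ * w)) τ :=
    hasDerivAt_powSum_ray expBounded_coeffI.derivCoeff w
  have hS : ∀ τ : ℝ, HasDerivAt (fun τ : ℝ => seriesS (τ * w)) (w * S₁ (τ * w)) τ :=
    hasDerivAt_powSum_ray expBounded_coeffS w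
  have hS₁ : ∀ τ : ℝ, HasDerivAt (fun τ : ℝ => S₁ (τ * w)) (w * S₂ (τ * w)) τ :=
    hasDerivAt_powSum_ray expBounded_coeffS.derivCoeff w
  have hM : ∀ τ : ℝ, 0 < τ → HasDerivAt (fun τ : ℝ => besselM (τ * a) b)
      (-a * P₀ (τ * a)) τ := fun τ hτ => by
    refine (hasDerivAt_laplace_ray (laplaceIntegrable_kernM hb) ha hτ).congr_deriv ?_
    congr 1
    refine laplace_congr (fun t ht => ?_) _
    have : (t : ℂ) ≠ 0 := by exact_mod_cast ht.ne'
    field_simp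
  have hP : ∀ τ : ℝ, 0 < τ → HasDerivAt (fun τ : ℝ => P₀ (τ * a)) (-a * P₁ (τ * a)) τ :=
    fun τ hτ => hasDerivAt_laplace_ray (laplaceIntegrable_expK hb.le) ha hτ
  -- The difference of the two sides along the ray, with its first two derivatives.
  have key := eq_zero_of_singular_ode (w := w) (τ := 1)
    (D := fun τ => besselM (τ * a) b - (-(l τ * seriesI (τ * w)) + 2 * seriesS (τ * w)))
    (D₁ := fun τ => -a * P₀ (τ * a) - (-((τ : ℂ)⁻¹ * seriesI (τ * w) + l τ * (w * I₁ (τ * w)))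
      + 2 * (w * S₁ (τ * w))))
    (D₂ := fun τ => -a * (-a * P₁ (τ * a)) -
      (-((-(1 : ℂ) / (τ : ℂ) ^ 2 * seriesI (τ * w) + (τ : ℂ)⁻¹ * (w * I₁ (τ * w)))
        + ((τ : ℂ)⁻¹ * (w * I₁ (τ * w)) + l τ * (w * (w * I₂ (τ * w)))))
      + 2 * (w * (w * S₂ (τ * w)))))
    (fun τ hτ => (hM τ hτ).sub (((hlog τ hτ).mul (hI τ)).neg.add ((hS τ).const_mul 2)))
    (fun τ hτ => ?_) (fun τ hτ => ?_) ?_ ?_ one_pos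
  · rw [sub_eq_zero] at key
    simp only [Complex.ofReal_one, one_mul, hl, Real.log_one, Complex.ofReal_zero, zero_add] at key
    rw [key, besselL, hw, log_mul_of_re_pos ha hb, hκ]
    ring
  · have h0 : (τ : ℂ) ≠ 0 := by exact_mod_cast hτ.ne'
    have hinv : HasDerivAt (fun τ : ℝ => (τ : ℂ)⁻¹) (-(1 : ℂ) / (τ : ℂ) ^ 2) τ :=
      ((hasDerivAt_id (τ : ℂ)).fun_inv h0).comp_ofReal
    exact ((hP τ hτ).const_mul (-a)).sub (((hinv.mul (hI τ)).add
      ((hlog τ hτ).mul ((hI₁ τ).const_mul w))).neg.add (((hS₁ τ).const_mul w).const_mul 2))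
  · have h0 : (τ : ℂ) ≠ 0 := by exact_mod_cast hτ.ne'
    have e1 := seriesI_ode (τ * w)
    have e2 := seriesS_ode (τ * w)
    have e3 := laplace_expK_relation (re_ofReal_mul_pos ha hτ) hb
    change P₀ (τ * a) + b * besselM (τ * a) b = τ * a * P₁ (τ * a) at e3
    change τ * w * I₂ (τ * w) + I₁ (τ * w) = _ at e1
    change τ * w * S₂ (τ * w) + S₁ (τ * w) = _ + I₁ (τ * w) at e2
    have e4 : (τ : ℂ) * (-(1 : ℂ) / (τ : ℂ) ^ 2 * seriesI (τ * w) + (τ : ℂ)⁻¹ * (w * I₁ (τ * w)))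
        = -(τ : ℂ)⁻¹ * seriesI (τ * w) + w * I₁ (τ * w) := by
      field_simp
    have e5 : (τ : ℂ) * ((τ : ℂ)⁻¹ * (w * I₁ (τ * w))) = w * I₁ (τ * w) := by field_simp
    linear_combination e4 + e5 + (-a) * e3 + w * l τ * e1 - 2 * w * e2 +
      besselM (τ * a) b * hw
  · have h1 := (tendsto_besselM_add_log ha hb).add_const κ
    have h2 := (tendsto_log_add_mul_rpow κ one_pos).mul (tendsto_seriesI_sub_one_div w)
    have h3 := (tendsto_powSum_ray expBounded_coeffS w).const_mul 2
    have h := (h1.add h2).sub h3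
    simp only [coeffS, harmonic_zero, Rat.cast_zero, zero_div, mul_zero, sub_zero, zero_mul,
      add_zero] at h
    rw [← hκ, neg_add_cancel] at h
    refine h.congr' ?_
    filter_upwards [self_mem_nhdsWithin] with τ hτ
    have h0 : (τ : ℂ) ≠ 0 := by exact_mod_cast (ne_of_gt hτ)
    rw [Real.rpow_one, mul_assoc, mul_div_cancel₀ _ h0]
    simp only [hl]
    change _ - 2 * seriesS _ = _
    ring
  · have hsq : Tendsto (fun τ : ℝ => ((τ ^ (1 / 2 : ℝ) : ℝ) : ℂ)) (𝓝[>] 0) (𝓝 0) := by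
      have := (tendsto_log_add_mul_rpow 1 (r := 1 / 2) (by norm_num)).sub
        (tendsto_log_add_mul_rpow 0 (r := 1 / 2) (by norm_num))
      rw [sub_zero] at this
      exact this.congr fun τ => by ring
    have h1 : Tendsto (fun τ : ℝ => ((τ ^ (-(1 / 2) : ℝ) : ℝ) : ℂ) *
        (1 - a * laplace (fun t => Complex.exp (-(τ * b) / t)) a)) (𝓝[>] 0) (𝓝 0) := by
      obtain ⟨C, hC⟩ := exists_norm_one_sub_mul_laplace_expK_le ha hb.le
      have h4 : Tendsto (fun τ : ℝ => C * τ ^ (1 / 4 : ℝ)) (𝓝[>] 0) (𝓝 0) := by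
        have := (Real.continuousAt_rpow_const 0 (1 / 4) (Or.inr (by norm_num))).tendsto
        rw [Real.zero_rpow (by norm_num)] at this
        simpa using (this.mono_left nhdsWithin_le_nhds).const_mul C
      refine squeeze_zero_norm' ?_ h4
      filter_upwards [self_mem_nhdsWithin] with τ hτ
      have hτ : 0 < τ := hτ
      rw [norm_mul, Complex.norm_real, Real.norm_of_nonneg (Real.rpow_nonneg hτ.le _)]
      calc _ ≤ τ ^ (-(1 / 2) : ℝ) * (C * τ ^ (3 / 4 : ℝ)) := by gcongr; exact hC τ hτ
        _ = C * (τ ^ (-(1 / 2) : ℝ) * τ ^ (3 / 4 : ℝ)) := by ring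
        _ = _ := by rw [← Real.rpow_add hτ]; norm_num
    have h2 := hsq.mul (tendsto_seriesI_sub_one_div w)
    have h3 := (tendsto_log_add_mul_rpow κ (r := 1 / 2) (by norm_num)).mul
      ((tendsto_powSum_ray expBounded_coeffI.derivCoeff w).const_mul w)
    have h5 := hsq.mul
      (((tendsto_powSum_ray expBounded_coeffS.derivCoeff w).const_mul w).const_mul 2)
    have h := ((h1.add h2).add h3).sub h5
    simp only [zero_mul, add_zero, sub_zero] at h
    refine h.congr' ?_
    filter_upwards [self_mem_nhdsWithin] with τ hτ
    have hτ : 0 < τ := hτ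
    have h0 : (τ : ℂ) ≠ 0 := by exact_mod_cast (ne_of_gt hτ)
    rw [← mul_laplace_expK_scale a b hτ, ← Real.sqrt_eq_rpow, Real.rpow_neg hτ.le,
      ← Real.sqrt_eq_rpow]
    have hs0 : (√τ : ℂ) ≠ 0 := by exact_mod_cast (Real.sqrt_pos.mpr hτ).ne'
    have hs1 : (τ : ℂ) = (√τ : ℂ) * (√τ : ℂ) := by
      exact_mod_cast (Real.mul_self_sqrt hτ.le).symm
    have hs2 : (((√τ)⁻¹ : ℝ) : ℂ) = √τ * (τ : ℂ)⁻¹ := by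
      push_cast
      field_simp
      rw [sq]
      exact hs1
    rw [hs2]
    change √τ * (τ : ℂ)⁻¹ * (1 - a * (τ * P₀ (τ * a))) + _ +
      (Real.log τ + κ) * √τ * (w * I₁ (τ * w)) - √τ * (2 * (w * S₁ (τ * w))) = _
    simp only [hl]
    field_simp
    ring

/-! ### A uniform bound up to the cut -/

theorem cexp_neg_div_mul_cexp (a : ℂ) (t : ℝ) :
    Complex.exp (-a / t) / t * Complex.exp (-a * t) = Complex.exp (-a * (t + 1 / t)) / t := by
  rw [div_mul_eq_mul_div, ← Complex.exp_add]
  congr 2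
  ring

theorem integrableOn_phase {a : ℂ} (ha : 0 < a.re) :
    IntegrableOn (fun t : ℝ => Complex.exp (-a * (t + 1 / t)) / t) (Ioi 0) :=
  ((laplaceIntegrable_kernM ha).integrable ha).congr
    (Eventually.of_forall fun t => cexp_neg_div_mul_cexp a t)

theorem besselM_self (a : ℂ) :
    besselM a a = ∫ t in Ioi (0 : ℝ), Complex.exp (-a * (t + 1 / t)) / t :=
  setIntegral_congr_fun measurableSet_Ioi fun t _ => cexp_neg_div_mul_cexp a t

/-- The substitution `t ↦ 1/t` exchanges `(0, 1)` and `(1, ∞)` and preserves the phase. -/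
theorem besselM_self_eq_two_mul {a : ℂ} (ha : 0 < a.re) :
    besselM a a = 2 * ∫ t in Ioi (1 : ℝ), Complex.exp (-a * (t + 1 / t)) / t := by
  have hint := integrableOn_phase ha
  set f : ℝ → ℂ := fun t : ℝ => Complex.exp (-a * (t + 1 / t)) / t
  have h1 : ∫ t in Ioc (0 : ℝ) 1, f t = ∫ t in Ioi (1 : ℝ), f t := by
    have e1 : ∫ t in Ioi (0 : ℝ), (Ioo (0 : ℝ) 1).indicator f t = ∫ t in Ioc (0 : ℝ) 1, f t := by
      rw [setIntegral_indicator measurableSet_Ioo, integral_Ioc_eq_integral_Ioo]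
      congr 2
      ext t
      simp only [mem_inter_iff, mem_Ioi, mem_Ioo]
      tauto
    have e2 : ∫ t in Ioi (0 : ℝ), (Ioi (1 : ℝ)).indicator f t = ∫ t in Ioi (1 : ℝ), f t := by
      rw [setIntegral_indicator measurableSet_Ioi]
      congr 2
      ext t
      simp only [mem_inter_iff, mem_Ioi]
      exact ⟨fun h => h.2, fun h => ⟨one_pos.trans h, h⟩⟩
    rw [← e1, ← e2, ← integral_Ioi_inv]
    refine setIntegral_congr_fun measurableSet_Ioi fun t ht => ?_
    have ht : (0 : ℝ) < t := ht
    have h0 : (t : ℂ) ≠ 0 := by exact_mod_cast ht.ne'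
    by_cases h : 1 < t
    · have h' : t⁻¹ ∈ Ioo (0 : ℝ) 1 := ⟨by positivity, inv_lt_one_of_one_lt₀ h⟩
      simp only [indicator_of_mem h', indicator_of_mem (show t ∈ Ioi 1 from h), f]
      push_cast
      rw [one_div, one_div, inv_inv, add_comm]
      field_simp
    · have h' : t⁻¹ ∉ Ioo (0 : ℝ) 1 := fun h' => h (by
        have := h'.2
        rwa [inv_lt_one₀ ht] at this)
      simp only [indicator_of_notMem h', indicator_of_notMem (show t ∉ Ioi 1 from h), zero_div]
  rw [besselM_self, ← Ioc_union_Ioi_eq_Ioi zero_le_one,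
    setIntegral_union (Ioc_disjoint_Ioi le_rfl) measurableSet_Ioi
      (hint.mono_set Ioc_subset_Ioi_self) (hint.mono_set (Ioi_subset_Ioi zero_le_one))]
  change (∫ t in Ioc (0 : ℝ) 1, f t) + _ = _
  rw [h1, two_mul]

theorem hasDerivAt_neg_inv_sub_inv {t : ℝ} (ht : 1 < t) :
    HasDerivAt (fun t : ℝ => -(t - t⁻¹)⁻¹) ((1 + (t ^ 2)⁻¹) / (t - t⁻¹) ^ 2) t := by
  have h1 : t - t⁻¹ ≠ 0 := (sub_pos.mpr ((inv_lt_one_of_one_lt₀ ht).trans ht)).ne'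
  have h0 : t ≠ 0 := by linarith
  refine (((hasDerivAt_id t).sub (hasDerivAt_inv h0)).fun_inv h1).neg.congr_deriv ?_
  simp only [Pi.sub_apply, id]
  ring

theorem tendsto_neg_inv_sub_inv : Tendsto (fun t : ℝ => -(t - t⁻¹)⁻¹) atTop (𝓝 0) := by
  have h : Tendsto (fun t : ℝ => t - t⁻¹) atTop atTop := by
    have := tendsto_inv_atTop_zero (𝕜 := ℝ)
    simpa [sub_eq_add_neg] using tendsto_id.atTop_add this.neg
  simpa using h.inv_tendsto_atTop.neg

/-- Van der Corput estimate away from the stationary point `t = 1` of the phase `t + 1/t`. -/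
theorem norm_integral_phase_tail_le {a : ℂ} (ha : 0 < a.re) {y : ℝ} (hy : 0 < y) :
    ‖∫ t in Ioi (1 + y), Complex.exp (-a * (t + 1 / t)) / t‖ ≤ 2 / (‖a‖ * y) := by
  have ha0 : a ≠ 0 := fun h => by simp [h] at ha
  have hna : 0 < ‖a‖ := norm_pos_iff.mpr ha0
  set v : ℝ → ℝ := fun t => -(t - t⁻¹)⁻¹ with hv
  set v' : ℝ → ℝ := fun t => (1 + (t ^ 2)⁻¹) / (t - t⁻¹) ^ 2
  set e : ℝ → ℂ := fun t => Complex.exp (-a * (t + 1 / t)) with he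
  have hyl : y ≤ (1 + y) - (1 + y)⁻¹ := by
    have : (1 + y)⁻¹ ≤ 1 := inv_le_one_of_one_le₀ (by linarith)
    linarith
  have hvy : ‖v (1 + y)‖ ≤ 1 / y := by
    simp only [hv]
    rw [norm_neg, norm_inv, Real.norm_of_nonneg (by linarith), one_div]
    exact inv_anti₀ hy hyl
  have hd : ∀ t ∈ Ici (1 + y), HasDerivAt v (v' t) t := fun t ht =>
    hasDerivAt_neg_inv_sub_inv (by have : 1 + y ≤ t := ht; linarith)
  have hv'0 : ∀ t ∈ Ioi (1 + y), 0 ≤ v' t := fun t _ => by positivity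
  have hv'i : IntegrableOn v' (Ioi (1 + y)) :=
    integrableOn_Ioi_deriv_of_nonneg' hd hv'0 tendsto_neg_inv_sub_inv
  have hv'v : ∫ t in Ioi (1 + y), v' t = 0 - v (1 + y) :=
    integral_Ioi_of_hasDerivAt_of_nonneg' hd hv'0 tendsto_neg_inv_sub_inv
  have he1 : ∀ t, 0 < t → ‖e t‖ ≤ 1 := fun t ht => by
    simp only [he]
    rw [show -a * ((t : ℂ) + 1 / t) = -a * ((t + 1 / t : ℝ) : ℂ) by push_cast; ring,
      norm_cexp_neg_mul_ofReal, Real.exp_le_one_iff, neg_mul, neg_nonpos]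
    positivity
  have hem : Measurable e := by fun_prop
  have hi1 : IntegrableOn (fun t => e t * (v' t : ℂ)) (Ioi (1 + y)) := by
    refine Integrable.bdd_mul (c := 1) hv'i.ofReal hem.aestronglyMeasurable ?_
    exact (ae_restrict_iff' measurableSet_Ioi).mpr (Eventually.of_forall fun t ht =>
      he1 t (by have : 1 + y < t := ht; linarith))
  have hi2 : IntegrableOn (fun t => e t / t) (Ioi (1 + y)) :=
    (integrableOn_phase ha).mono_set (Ioi_subset_Ioi (by linarith))
  -- With `v = -1/(t - 1/t)` one has `(e v)' = e v' + a e / t`, so that the integral is controlled by a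
  -- boundary term and by `∫ v' = -v(1 + y)`, as `v' ≥ 0` and `|e| ≤ 1`.
  have key := integral_Ioi_of_hasDerivAt_of_tendsto' (a := 1 + y) (m := 0)
    (f := fun t : ℝ => e t * (v t : ℂ)) (f' := fun t => e t * (v' t : ℂ) + a * (e t / t))
    (fun t ht => ?_) (hi1.add (hi2.const_mul a)) ?_
  · replace key := (integral_add hi1 (hi2.const_mul a)).symm.trans key
    rw [integral_const_mul] at key
    have h1 : ‖∫ t in Ioi (1 + y), e t * (v' t : ℂ)‖ ≤ 1 / y := by
      have : ‖∫ t in Ioi (1 + y), e t * (v' t : ℂ)‖ ≤ ∫ t in Ioi (1 + y), v' t := by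
        refine norm_integral_le_of_norm_le hv'i ?_
        refine (ae_restrict_iff' measurableSet_Ioi).mpr (Eventually.of_forall fun t ht => ?_)
        rw [norm_mul, Complex.norm_real, Real.norm_of_nonneg (hv'0 t ht)]
        exact mul_le_of_le_one_left (hv'0 t ht)
          (he1 t (by have : 1 + y < t := ht; linarith))
      rw [hv'v, zero_sub] at this
      exact this.trans ((le_abs_self _).trans (by rw [abs_neg]; exact hvy))
    have h2 : ‖e (1 + y) * (v (1 + y) : ℂ)‖ ≤ 1 / y := by
      rw [norm_mul, Complex.norm_real]
      calc _ ≤ 1 * (1 / y) := by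
            gcongr
            exact he1 _ (by linarith)
        _ = _ := one_mul _
    have h3 : a * ∫ t in Ioi (1 + y), e t / t
        = -(e (1 + y) * (v (1 + y) : ℂ)) - ∫ t in Ioi (1 + y), e t * (v' t : ℂ) := by
      linear_combination key
    have h4 : ‖a‖ * ‖∫ t in Ioi (1 + y), e t / t‖ ≤ 2 / y := by
      rw [← norm_mul, h3]
      refine (norm_sub_le _ _).trans ?_
      rw [norm_neg]
      calc _ ≤ 1 / y + 1 / y := add_le_add h2 h1
        _ = _ := by ring
    rw [← div_div, div_right_comm, le_div_iff₀ hna, mul_comm]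
    exact h4
  · have ht : 1 + y ≤ t := ht
    have ht0 : 0 < t := by linarith
    have h0 : (t : ℂ) ≠ 0 := by exact_mod_cast ht0.ne'
    have hne : t - t⁻¹ ≠ 0 :=
      (sub_pos.mpr ((inv_lt_one_of_one_lt₀ (by linarith)).trans (by linarith))).ne'
    have hne' : (t : ℂ) - (t : ℂ)⁻¹ ≠ 0 := by exact_mod_cast hne
    have d1 := hasDerivAt_phase a a ht0
    have d2 : HasDerivAt e ((a / t ^ 2 - a) * e t) t := by
      have e1 : e = fun t : ℝ => Complex.exp (-a / t) * Complex.exp (-a * t) := by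
        funext t
        rw [← Complex.exp_add]
        simp only [he]
        congr 1
        ring
      rw [e1]
      exact d1
    refine (d2.mul (hd t ht).ofReal_comp).congr_deriv ?_
    rw [add_comm]
    congr 1
    simp only [hv]
    push_cast
    have h3 : (t : ℂ) ^ 2 - 1 ≠ 0 := by
      intro h
      apply hne'
      field_simp
      rw [h, mul_zero]
    have h4 : (t : ℂ) - (t : ℂ)⁻¹ = ((t : ℂ) ^ 2 - 1) / t := by field_simp
    rw [h4]
    field_simp
    ring
  · have h0 : Tendsto (fun t => ‖v t‖) atTop (𝓝 0) := by
      have := tendsto_neg_inv_sub_inv.norm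
      rwa [norm_zero] at this
    refine squeeze_zero_norm' ?_ h0
    filter_upwards [eventually_gt_atTop 0] with t ht
    rw [norm_mul, Complex.norm_real]
    exact mul_le_of_le_one_left (norm_nonneg _) (he1 t ht)

/-- The interval `(1, 1 + y)` contributes at most `y` and the tail at most `2 / (|a| y)`; the choice
`y = |a|^{-1/2}` balances the two. -/
theorem norm_besselM_self_le {a : ℂ} (ha : 0 < a.re) :
    ‖besselM a a‖ ≤ 6 * ‖a‖ ^ (-(1 / 2) : ℝ) := by
  have ha0 : a ≠ 0 := fun h => by simp [h] at ha
  have hna : 0 < ‖a‖ := norm_pos_iff.mpr ha0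
  set y : ℝ := ‖a‖ ^ (-(1 / 2) : ℝ) with hy
  have hy0 : 0 < y := by positivity
  have hyy : 1 / (‖a‖ * y) = y := by
    have : ‖a‖ * y * y = 1 := by
      rw [mul_assoc, hy, ← Real.rpow_add hna]
      norm_num
      rw [Real.rpow_neg_one, mul_inv_cancel₀ hna.ne']
    field_simp
    linarith
  set f : ℝ → ℂ := fun t : ℝ => Complex.exp (-a * (t + 1 / t)) / t with hf
  have hint : IntegrableOn f (Ioi 0) := integrableOn_phase ha
  have h1 : ‖∫ t in Ioc 1 (1 + y), f t‖ ≤ y := by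
    have := norm_setIntegral_le_of_norm_le_const (μ := volume) (s := Ioc 1 (1 + y)) (f := f)
      (C := 1) (by simp) (fun t ht => ?_)
    · simpa [Measure.real, hy0.le] using this
    · have h1t : 1 < t := ht.1
      simp only [hf]
      rw [norm_div, Complex.norm_real, Real.norm_of_nonneg (by linarith),
        div_le_one (by linarith),
        show -a * ((t : ℂ) + 1 / t) = -a * ((t + 1 / t : ℝ) : ℂ) by push_cast; ring,
        norm_cexp_neg_mul_ofReal]
      refine le_trans (Real.exp_le_one_iff.mpr ?_) h1t.le
      rw [neg_mul, neg_nonpos]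
      positivity
  have h2 := norm_integral_phase_tail_le ha hy0
  rw [besselM_self_eq_two_mul ha, ← Ioc_union_Ioi_eq_Ioi (show (1 : ℝ) ≤ 1 + y by linarith),
    setIntegral_union (Ioc_disjoint_Ioi le_rfl) measurableSet_Ioi
      (hint.mono_set fun t ht => one_pos.trans ht.1)
      (hint.mono_set fun t ht => by
        have : 1 + y < t := ht
        exact show (0 : ℝ) < t by linarith), norm_mul, Complex.norm_ofNat]
  have h3 := norm_add_le (∫ t in Ioc 1 (1 + y), f t) (∫ t in Ioi (1 + y), f t)
  have h4 : 2 / (‖a‖ * y) = 2 * y := by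
    rw [show 2 / (‖a‖ * y) = 2 * (1 / (‖a‖ * y)) by ring, hyy]
  rw [h4] at h2
  change 2 * ‖(∫ t in Ioc 1 (1 + y), f t) + (∫ t in Ioi (1 + y), f t)‖ ≤ 6 * y
  change ‖∫ t in Ioi (1 + y), f t‖ ≤ 2 * y at h2
  linarith

/-- The bound `|2 K₀(2√w)| ≤ 6 |w|^{-1/4}`, uniform up to the cut. -/
theorem norm_besselL_le {w : ℂ} (hw : w ∈ Complex.slitPlane) :
    ‖besselL w‖ ≤ 6 * ‖w‖ ^ (-(1 / 4) : ℝ) := by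
  set a : ℂ := w ^ (1 / 2 : ℂ) with ha
  have hw0 := Complex.slitPlane_ne_zero hw
  have haa : a * a = w := by
    rw [ha, ← Complex.cpow_add _ _ hw0]; norm_num
  have hre : 0 < a.re := by
    have h1 := Complex.neg_pi_lt_arg w
    have h2 := (Complex.arg_le_pi w).lt_of_ne (Complex.mem_slitPlane_iff_arg.mp hw).1
    rw [ha, Complex.cpow_def_of_ne_zero hw0, Complex.exp_re]
    have him : (Complex.log w * (1 / 2)).im = w.arg / 2 := by
      rw [show (1 / 2 : ℂ) = ((1 / 2 : ℝ) : ℂ) by push_cast; ring, Complex.im_mul_ofReal,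
        Complex.log_im]
      ring
    rw [him]
    exact mul_pos (Real.exp_pos _) (Real.cos_pos_of_mem_Ioo ⟨by linarith, by linarith⟩)
  have hn : ‖w‖ ^ (-(1 / 4) : ℝ) = ‖a‖ ^ (-(1 / 2) : ℝ) := by
    rw [← haa, norm_mul, ← sq, ← Real.rpow_natCast, ← Real.rpow_mul (norm_nonneg _)]
    norm_num
  rw [hn, ← haa, ← besselM_eq_besselL hre hre]
  exact norm_besselM_self_le hre

end BesselK

/-! ### Integrability of `|N|^{-1/4}` -/

namespace SplitQuat
open Set BesselK
open scoped ENNReal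

theorem dualForm_self (ξ : SplitQuat) : dualForm ξ ξ = N ξ := by
  simp only [dualForm, N]; ring

theorem continuous_N : Continuous N := by unfold N; fun_prop

theorem measurable_N : Measurable N := continuous_N.measurable

theorem enorm_rpow_neg_le_of_le {x y : ℝ} {r : ℝ} (hr : 0 ≤ r) (h : ‖x‖ ≤ ‖y‖) :
    ‖y‖ₑ ^ (-r) ≤ ‖x‖ₑ ^ (-r) := by
  rw [ENNReal.rpow_neg, ENNReal.rpow_neg, ENNReal.inv_le_inv]
  refine ENNReal.rpow_le_rpow ?_ hr
  rw [← ofReal_norm, ← ofReal_norm]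
  exact ENNReal.ofReal_le_ofReal h

/-- The singularity of `|x² - a|^{-1/4}` is dominated by two singularities of order `1/2`. -/
theorem exists_enorm_sq_sub_rpow_le (a : ℝ) : ∃ b : ℝ, ∀ x : ℝ,
    ‖x ^ 2 - a‖ₑ ^ (-(1 / 4) : ℝ) ≤ ‖x - b‖ₑ ^ (-(1 / 2) : ℝ) + ‖x - -b‖ₑ ^ (-(1 / 2) : ℝ) := by
  have hsq : ∀ y : ℝ, ‖y ^ 2‖ₑ ^ (-(1 / 4) : ℝ) = ‖y‖ₑ ^ (-(1 / 2) : ℝ) := fun y => by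
    rw [enorm_pow, ← ENNReal.rpow_natCast, ← ENNReal.rpow_mul]
    norm_num
  rcases le_total a 0 with ha | ha
  · refine ⟨0, fun x => ?_⟩
    rw [sub_zero, ← hsq x]
    refine le_trans (enorm_rpow_neg_le_of_le (by norm_num) ?_) le_self_add
    rw [Real.norm_of_nonneg (by positivity), Real.norm_of_nonneg (by nlinarith [sq_nonneg x])]
    linarith
  · refine ⟨√a, fun x => ?_⟩
    have hfac : ‖x ^ 2 - a‖ = ‖x - √a‖ * ‖x - -√a‖ := by
      rw [← norm_mul]
      congr 1
      nlinarith [Real.mul_self_sqrt ha]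
    rcases le_total ‖x - √a‖ ‖x - -√a‖ with h | h
    · refine le_trans ?_ le_self_add
      rw [← hsq]
      refine enorm_rpow_neg_le_of_le (by norm_num) ?_
      rw [norm_pow, hfac, sq]
      gcongr
    · refine le_trans ?_ le_add_self
      rw [← hsq]
      refine enorm_rpow_neg_le_of_le (by norm_num) ?_
      rw [norm_pow, hfac, sq]
      gcongr

theorem lintegral_ball_rpow_lt_top :
    ∫⁻ x in Metric.ball (0 : ℝ) 1, ‖x‖ₑ ^ (-(1 / 2) : ℝ) < ∞ := by
  have h : IntegrableOn (fun x : ℝ => ‖x‖ ^ (-(1 / 2) : ℝ)) (Metric.ball 0 1) := by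
    rw [integrableOn_fun_norm_addHaar volume (f := fun y : ℝ => y ^ (-(1 / 2) : ℝ))]
    simp only [Module.finrank_self, tsub_self, pow_zero, one_smul]
    exact (intervalIntegral.integrableOn_Ioo_rpow_iff one_pos).mpr (by norm_num)
  refine lt_of_eq_of_lt (lintegral_congr_ae ?_) h.hasFiniteIntegral
  have : ∀ᵐ x : ℝ, x ≠ 0 := by simp [ae_iff, measure_singleton]
  filter_upwards [ae_restrict_of_ae this] with x hx
  have hx' : 0 < ‖x‖ := norm_pos_iff.mpr hx
  rw [Real.enorm_of_nonneg (Real.rpow_nonneg hx'.le _), ← ENNReal.ofReal_rpow_of_pos hx',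
    ofReal_norm]

/-- Up to a bounded part, a singularity of order `1/2` is supported in the unit ball, and the bound on
its integral does not depend on its position. -/
theorem exists_lintegral_sub_rpow_le : ∃ K : ℝ≥0∞, K < ∞ ∧ ∀ b : ℝ,
    ∫⁻ x : ℝ, ‖x - b‖ₑ ^ (-(1 / 2) : ℝ) * ENNReal.ofReal (1 + x ^ 2)⁻¹ ≤ K := by
  set g : ℝ → ℝ≥0∞ := (Metric.ball (0 : ℝ) 1).indicator fun x => ‖x‖ₑ ^ (-(1 / 2) : ℝ) with hg
  have hgm : Measurable g := Measurable.indicator (by fun_prop) Metric.isOpen_ball.measurableSet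
  refine ⟨(∫⁻ x : ℝ, ENNReal.ofReal (1 + x ^ 2)⁻¹) + ∫⁻ x, g x, ?_, fun b => ?_⟩
  · refine ENNReal.add_lt_top.mpr ⟨?_, ?_⟩
    · have := integrable_inv_one_add_sq.hasFiniteIntegral
      refine lt_of_eq_of_lt (lintegral_congr fun x => ?_) this
      rw [Real.enorm_of_nonneg (by positivity)]
    · rw [hg, lintegral_indicator Metric.isOpen_ball.measurableSet]
      exact lintegral_ball_rpow_lt_top
  · rw [← lintegral_sub_right_eq_self g b, ← lintegral_add_left (by fun_prop)]
    refine lintegral_mono fun x => ?_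
    by_cases h : x - b ∈ Metric.ball (0 : ℝ) 1
    · simp only [hg, indicator_of_mem h]
      refine le_trans ?_ le_add_self
      refine mul_le_of_le_one_right' ?_
      rw [← ENNReal.ofReal_one]
      exact ENNReal.ofReal_le_ofReal (inv_le_one_of_one_le₀ (by nlinarith [sq_nonneg x]))
    · simp only [hg, indicator_of_notMem h, add_zero]
      refine mul_le_of_le_one_left' ?_
      rw [mem_ball_zero_iff, not_lt] at h
      have := enorm_rpow_neg_le_of_le (x := 1) (y := x - b) (r := 1 / 2) (by norm_num)
        (by simpa using h)
      simpa using this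

/-- The one-dimensional slices of the weight have uniformly bounded integrals. -/
theorem exists_lintegral_sq_sub_rpow_le : ∃ K : ℝ≥0∞, K < ∞ ∧ ∀ a : ℝ,
    ∫⁻ x : ℝ, ‖x ^ 2 - a‖ₑ ^ (-(1 / 4) : ℝ) * ENNReal.ofReal (1 + x ^ 2)⁻¹ ≤ K := by
  obtain ⟨K, hK, h⟩ := exists_lintegral_sub_rpow_le
  refine ⟨K + K, ENNReal.add_lt_top.mpr ⟨hK, hK⟩, fun a => ?_⟩
  obtain ⟨b, hb⟩ := exists_enorm_sq_sub_rpow_le a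
  refine le_trans ?_ (add_le_add (h b) (h (-b)))
  rw [← lintegral_add_left (by fun_prop)]
  refine lintegral_mono fun x => ?_
  rw [← add_mul]
  gcongr
  exact hb x

/-- Separation of the coordinate `x₁` from the three others. -/
theorem measurePreserving_slice :
    MeasurePreserving (fun ξ : SplitQuat => (ξ 0, fun i : Fin 3 => ξ i.succ)) :=
  (volume_preserving_piFinSuccAbove (fun _ : Fin 4 => ℝ) 0).comp
    (PiLp.volume_preserving_ofLp (Fin 4))

theorem lintegral_norm_rpow_lt_top :
    ∫⁻ ξ : SplitQuat, ‖N ξ‖ₑ ^ (-(1 / 4) : ℝ) * ENNReal.ofReal ((1 + ‖ξ‖) ^ (-(6 : ℝ))) < ∞ := by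
  obtain ⟨K, hK, hKa⟩ := exists_lintegral_sq_sub_rpow_le
  set a : (Fin 3 → ℝ) → ℝ := fun z => z 1 ^ 2 + z 2 ^ 2 - z 0 ^ 2 with ha
  set H : ℝ × (Fin 3 → ℝ) → ℝ≥0∞ := fun p => ‖p.1 ^ 2 - a p.2‖ₑ ^ (-(1 / 4) : ℝ) *
    ENNReal.ofReal (1 + p.1 ^ 2)⁻¹ * ENNReal.ofReal ((1 + ‖p.2‖) ^ (-(4 : ℝ))) with hH
  have hHm : Measurable H := by fun_prop
  have h1 : ∀ ξ : SplitQuat, ‖N ξ‖ₑ ^ (-(1 / 4) : ℝ) * ENNReal.ofReal ((1 + ‖ξ‖) ^ (-(6 : ℝ)))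
      ≤ H (ξ 0, fun i : Fin 3 => ξ i.succ) := by
    intro ξ
    simp only [hH]
    rw [mul_assoc, ← ENNReal.ofReal_mul (by positivity)]
    refine mul_le_mul' (le_of_eq ?_) (ENNReal.ofReal_le_ofReal ?_)
    · congr 2
      simp only [N, ha]
      change ξ 0 ^ 2 + ξ 1 ^ 2 - ξ 2 ^ 2 - ξ 3 ^ 2 = ξ 0 ^ 2 - (ξ 2 ^ 2 + ξ 3 ^ 2 - ξ 1 ^ 2)
      ring
    · have h0 : ‖ξ 0‖ ≤ ‖ξ‖ := PiLp.norm_apply_le ξ 0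
      have hz : ‖fun i : Fin 3 => ξ i.succ‖ ≤ ‖ξ‖ :=
        (pi_norm_le_iff_of_nonneg (norm_nonneg _)).mpr fun i => PiLp.norm_apply_le ξ i.succ
      -- Decay of order `2` is spent on the coordinate `x₁`, and of order `4 > 3` on the others.
      rw [show (-(6 : ℝ)) = -(2 : ℕ) + -(4 : ℝ) by norm_num, Real.rpow_add (by positivity)]
      refine mul_le_mul ?_ ?_ (by positivity) (by positivity)
      · rw [Real.rpow_neg (by positivity), Real.rpow_natCast]
        refine inv_anti₀ (by positivity) ?_
        have : ξ 0 ^ 2 ≤ ‖ξ‖ ^ 2 := by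
          rw [← sq_abs, ← Real.norm_eq_abs]
          gcongr
        nlinarith [norm_nonneg ξ]
      · exact Real.rpow_le_rpow_of_nonpos (by positivity) (by linarith) (by norm_num)
  refine (lintegral_mono h1).trans_lt ?_
  rw [measurePreserving_slice.lintegral_comp hHm, Measure.volume_eq_prod,
    lintegral_prod_symm _ hHm.aemeasurable]
  have h2 : ∀ z : Fin 3 → ℝ, ∫⁻ x : ℝ, H (x, z) ≤ K * ENNReal.ofReal ((1 + ‖z‖) ^ (-(4 : ℝ))) := by
    intro z
    simp only [hH]
    rw [lintegral_mul_const _ (by fun_prop)]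
    gcongr
    exact hKa (a z)
  refine (lintegral_mono h2).trans_lt ?_
  rw [lintegral_const_mul _ (by fun_prop)]
  refine ENNReal.mul_lt_top hK (finite_integral_one_add_norm (by simp; norm_num))

/-- The isotropic cone is a null set: the weight `|N|^{-1/4}`, taken in `ℝ≥0∞`, is infinite on it and
has a finite integral. -/
theorem ae_N_ne_zero : ∀ᵐ ξ : SplitQuat, N ξ ≠ 0 := by
  have hm := measurable_N
  filter_upwards [ae_lt_top (by fun_prop) lintegral_norm_rpow_lt_top.ne] with ξ hξ h0
  rw [h0, enorm_zero, ENNReal.zero_rpow_of_neg (by norm_num), ENNReal.top_mul] at hξ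
  · exact lt_irrefl _ hξ
  · simp only [ne_eq, ENNReal.ofReal_eq_zero, not_le]
    positivity

theorem integrable_abs_N_rpow :
    Integrable fun ξ : SplitQuat => |N ξ| ^ (-(1 / 4) : ℝ) * (1 + ‖ξ‖) ^ (-(6 : ℝ)) := by
  have hm := measurable_N
  refine ⟨Measurable.aestronglyMeasurable (by fun_prop), ?_⟩
  refine lt_of_eq_of_lt (lintegral_congr_ae ?_) lintegral_norm_rpow_lt_top
  filter_upwards [ae_N_ne_zero] with ξ hξ
  have h : 0 < |N ξ| := abs_pos.mpr hξ
  rw [enorm_mul, Real.enorm_of_nonneg (Real.rpow_nonneg h.le _),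
    Real.enorm_of_nonneg (by positivity), ← ENNReal.ofReal_rpow_of_pos h, Real.enorm_eq_ofReal_abs]

theorem norm_schwartz_le (φ : 𝓢(SplitQuat, ℂ)) (ξ : SplitQuat) :
    ‖φ ξ‖ ≤ 2 ^ 6 * (Finset.Iic (6, 0)).sup (schwartzSeminormFamily ℂ SplitQuat ℂ) φ *
      (1 + ‖ξ‖) ^ (-(6 : ℝ)) := by
  have h := SchwartzMap.one_add_le_sup_seminorm_apply (𝕜 := ℂ) (m := (6, 0)) (k := 6) (n := 0)
    le_rfl le_rfl φ ξ
  rw [norm_iteratedFDeriv_zero] at h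
  rw [Real.rpow_neg (by positivity), show (6 : ℝ) = (6 : ℕ) by norm_num, Real.rpow_natCast,
    ← div_eq_mul_inv, le_div_iff₀ (by positivity), mul_comm]
  exact h

theorem integrable_abs_N_rpow_mul (φ : 𝓢(SplitQuat, ℂ)) :
    Integrable fun ξ : SplitQuat => |N ξ| ^ (-(1 / 4) : ℝ) * ‖φ ξ‖ := by
  have hm := measurable_N
  refine (integrable_abs_N_rpow.const_mul
    (2 ^ 6 * (Finset.Iic (6, 0)).sup (schwartzSeminormFamily ℂ SplitQuat ℂ) φ)).mono' ?_
    (Eventually.of_forall fun ξ => ?_)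
  · exact (Measurable.aestronglyMeasurable (by fun_prop)).mul φ.continuous.norm.aestronglyMeasurable
  · rw [norm_mul, norm_norm, Real.norm_of_nonneg (by positivity), mul_left_comm]
    gcongr
    exact norm_schwartz_le φ ξ

/-! ### Fourier transforms of imaginary Gaussians and of `(N + c + i s ε)⁻²` -/

/-- Fubini's theorem for a product of integrable functions with a bounded kernel. -/
theorem integral_mul_integral_swap {α β : Type*} [MeasurableSpace α] [MeasurableSpace β]
    {μ : Measure α} {ν : Measure β} [SFinite μ] [SFinite ν] {f : α → ℂ} {g : β → ℂ}
    {k : α → β → ℂ} (hf : Integrable f μ) (hg : Integrable g ν)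
    (hk : Measurable (Function.uncurry k)) (hb : ∀ x y, ‖k x y‖ ≤ 1) :
    ∫ x, f x * ∫ y, g y * k x y ∂ν ∂μ = ∫ y, g y * ∫ x, f x * k x y ∂μ ∂ν := by
  have h : Integrable (Function.uncurry fun x y => f x * (g y * k x y)) (μ.prod ν) := by
    refine (Integrable.bdd_mul (hf.mul_prod hg) (f := Function.uncurry k) (c := 1)
      hk.aestronglyMeasurable (Eventually.of_forall fun p => hb p.1 p.2)).congr
      (Eventually.of_forall fun p => ?_)
    simp only [Function.uncurry]
    ring
  simp only [← integral_const_mul]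
  rw [integral_integral_swap h]
  refine integral_congr_ae (Eventually.of_forall fun y => integral_congr_ae
    (Eventually.of_forall fun x => ?_))
  simp only
  ring

/-- The coefficients of the damped quadratic form `δ |X|² - i c N(X)` in the coordinates of `X`. -/
noncomputable def gaussCoeff (c δ : ℝ) : Fin 4 → ℂ :=
  ![δ - Complex.I * c, δ - Complex.I * c, δ + Complex.I * c, δ + Complex.I * c]

theorem gaussCoeff_re (c δ : ℝ) (j : Fin 4) : (gaussCoeff c δ j).re = δ := by
  fin_cases j <;> simp [gaussCoeff]

theorem gaussCoeff_ne_zero {c : ℝ} (hc : c ≠ 0) (δ : ℝ) (j : Fin 4) : gaussCoeff c δ j ≠ 0 := by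
  intro h
  have := congrArg Complex.im h
  fin_cases j <;> simp [gaussCoeff, hc] at this

theorem integral_gauss_mul_character {c δ : ℝ} (hδ : 0 < δ) (ξ : SplitQuat) :
    ∫ X : SplitQuat, Complex.exp (-∑ j, gaussCoeff c δ j * (X j : ℂ) ^ 2) *
        Complex.exp (Complex.I * ((∑ j, ξ j * X j : ℝ) : ℂ))
      = (Real.pi ^ 2 / (δ ^ 2 + c ^ 2) : ℂ) *
        Complex.exp (-∑ j, (ξ j : ℂ) ^ 2 / (4 * gaussCoeff c δ j)) := by
  have hre : ∀ j, 0 < (gaussCoeff c δ j).re := fun j => by rwa [gaussCoeff_re]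
  have hne : ∀ j, gaussCoeff c δ j ≠ 0 := fun j h => by
    have := hre j
    simp [h] at this
  have h := GaussianFourier.integral_cexp_neg_sum_mul_add hre (fun j => Complex.I * ξ j)
  rw [← (PiLp.volume_preserving_ofLp (Fin 4)).integral_comp
    (MeasurableEquiv.toLp 2 (Fin 4 → ℝ)).symm.measurableEmbedding] at h
  calc _ = ∫ X : SplitQuat, Complex.exp (-∑ j, gaussCoeff c δ j * (X j : ℂ) ^ 2 +
        ∑ j, Complex.I * ξ j * X j) := by
        refine integral_congr_ae (Eventually.of_forall fun X => ?_)
        simp only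
        rw [← Complex.exp_add]
        congr 2
        push_cast
        rw [Finset.mul_sum]
        exact Finset.sum_congr rfl fun j _ => by ring
    _ = _ := h
    _ = _ := by
        rw [Finset.prod_mul_distrib, ← Complex.exp_sum, ← Finset.sum_neg_distrib]
        congr 1
        · have hsq : ∀ z : ℂ, z ≠ 0 → z ^ (1 / 2 : ℂ) * z ^ (1 / 2 : ℂ) = z := fun z hz => by
            rw [← Complex.cpow_add _ _ hz]; norm_num
          have hpi : (Real.pi : ℂ) ≠ 0 := by exact_mod_cast Real.pi_ne_zero
          rw [Fin.prod_univ_four]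
          have h1 := hne 0
          have h2 := hne 2
          change ((Real.pi : ℂ) / gaussCoeff c δ 0) ^ (1 / 2 : ℂ) *
            ((Real.pi : ℂ) / gaussCoeff c δ 0) ^ (1 / 2 : ℂ) *
            ((Real.pi : ℂ) / gaussCoeff c δ 2) ^ (1 / 2 : ℂ) *
            ((Real.pi : ℂ) / gaussCoeff c δ 2) ^ (1 / 2 : ℂ) = _
          rw [hsq _ (div_ne_zero hpi h1), mul_assoc, hsq _ (div_ne_zero hpi h2),
            div_mul_div_comm, ← sq]
          congr 1
          change (δ - Complex.I * c : ℂ) * (δ + Complex.I * c) = _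
          linear_combination (-(c : ℂ) ^ 2) * Complex.I_sq
        · congr 1
          refine Finset.sum_congr rfl fun j _ => ?_
          rw [mul_pow, Complex.I_sq]
          ring

theorem norm_gauss_le_one {c δ : ℝ} (hδ : 0 ≤ δ) (X : SplitQuat) :
    ‖Complex.exp (-∑ j, gaussCoeff c δ j * (X j : ℂ) ^ 2)‖ ≤ 1 := by
  rw [Complex.norm_exp, Real.exp_le_one_iff, Complex.neg_re, neg_nonpos, Complex.re_sum]
  refine Finset.sum_nonneg fun j _ => ?_
  rw [← Complex.ofReal_pow, Complex.re_mul_ofReal, gaussCoeff_re]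
  positivity

theorem norm_gauss_inv_le_one {c δ : ℝ} (hδ : 0 ≤ δ) (X : SplitQuat) :
    ‖Complex.exp (-∑ j, (X j : ℂ) ^ 2 / (4 * gaussCoeff c δ j))‖ ≤ 1 := by
  rw [Complex.norm_exp, Real.exp_le_one_iff, Complex.neg_re, neg_nonpos, Complex.re_sum]
  refine Finset.sum_nonneg fun j _ => ?_
  rw [← Complex.ofReal_pow, div_eq_mul_inv, Complex.re_ofReal_mul, Complex.inv_re]
  have : (4 * gaussCoeff c δ j).re = 4 * δ := by
    rw [show (4 : ℂ) = ((4 : ℝ) : ℂ) by norm_num, Complex.re_ofReal_mul, gaussCoeff_re]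
  rw [this]
  have := Complex.normSq_nonneg (4 * gaussCoeff c δ j)
  positivity

theorem integrable_gauss {c δ : ℝ} (hδ : 0 < δ) :
    Integrable fun X : SplitQuat => Complex.exp (-∑ j, gaussCoeff c δ j * (X j : ℂ) ^ 2) := by
  have h := GaussianFourier.integrable_cexp_neg_sum_mul_add (b := gaussCoeff c δ)
    (fun j => by rwa [gaussCoeff_re]) (fun _ => 0)
  rw [← (PiLp.volume_preserving_ofLp (Fin 4)).integrable_comp_emb
    (MeasurableEquiv.toLp 2 (Fin 4 → ℝ)).symm.measurableEmbedding] at h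
  refine h.congr (Eventually.of_forall fun X => ?_)
  simp

/-- Parseval's identity for the damped Gaussian `e^{icN - δ|X|²}`. -/
theorem integral_fourierSchwartz_mul_damped {c δ : ℝ} (hδ : 0 < δ) (φ : 𝓢(SplitQuat, ℂ)) :
    ∫ X, fourierSchwartz φ X * Complex.exp (-∑ j, gaussCoeff c δ j * (X j : ℂ) ^ 2)
      = (4 * (δ ^ 2 + c ^ 2) : ℂ)⁻¹ *
        ∫ ξ, φ ξ * Complex.exp (-∑ j, (ξ j : ℂ) ^ 2 / (4 * gaussCoeff c δ j)) := by
  have hpi : (Real.pi : ℂ) ≠ 0 := by exact_mod_cast Real.pi_ne_zero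
  have hsw := integral_mul_integral_swap (integrable_gauss (c := c) hδ) (φ.integrable (μ := volume))
    (k := fun X ξ : SplitQuat => Complex.exp (Complex.I * ((∑ j, ξ j * X j : ℝ) : ℂ)))
    (by unfold Function.uncurry; fun_prop)
    (fun X ξ => by rw [mul_comm, Complex.norm_exp_ofReal_mul_I])
  calc _ = (((2 * Real.pi) ^ 2 : ℝ) : ℂ)⁻¹ *
        ∫ X : SplitQuat, Complex.exp (-∑ j, gaussCoeff c δ j * (X j : ℂ) ^ 2) *
          ∫ ξ : SplitQuat, φ ξ * Complex.exp (Complex.I * ((∑ j, ξ j * X j : ℝ) : ℂ)) := by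
        rw [← integral_const_mul]
        refine integral_congr_ae (Eventually.of_forall fun X => ?_)
        simp only [fourierSchwartz_apply]
        ring
    _ = _ := by
        rw [hsw, ← integral_const_mul, ← integral_const_mul]
        refine integral_congr_ae (Eventually.of_forall fun ξ => ?_)
        simp only
        rw [integral_gauss_mul_character hδ]
        push_cast
        field_simp
        ring

/-- The Fourier transform of the imaginary Gaussian `e^{icN}` is `e^{-iN/(4c)} / (4c²)`; the
signature `(2, 2)` makes the phases of the four one-dimensional factors cancel. -/
theorem integral_fourierSchwartz_mul_cexp_N {c : ℝ} (hc : c ≠ 0) (φ : 𝓢(SplitQuat, ℂ)) :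
    ∫ X, fourierSchwartz φ X * Complex.exp (((c * N X : ℝ) : ℂ) * Complex.I)
      = (4 * c ^ 2 : ℂ)⁻¹ * ∫ ξ, φ ξ * Complex.exp (((-N ξ / (4 * c) : ℝ) : ℂ) * Complex.I) := by
  have hcC : (c : ℂ) ≠ 0 := by exact_mod_cast hc
  have hg : ∀ j, Continuous fun δ : ℝ => gaussCoeff c δ j := fun j => by
    fin_cases j <;> simp only [gaussCoeff] <;>
    [change Continuous fun δ : ℝ => (δ - Complex.I * c : ℂ);
     change Continuous fun δ : ℝ => (δ - Complex.I * c : ℂ);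
     change Continuous fun δ : ℝ => (δ + Complex.I * c : ℂ);
     change Continuous fun δ : ℝ => (δ + Complex.I * c : ℂ)] <;> fun_prop
  have hL : Tendsto (fun δ : ℝ => ∫ X, fourierSchwartz φ X *
      Complex.exp (-∑ j, gaussCoeff c δ j * (X j : ℂ) ^ 2)) (𝓝[>] 0)
      (𝓝 (∫ X, fourierSchwartz φ X * Complex.exp (((c * N X : ℝ) : ℂ) * Complex.I))) := by
    refine tendsto_integral_filter_of_dominated_convergence (fun X => ‖fourierSchwartz φ X‖)
      (Eventually.of_forall fun δ => ?_) ?_ (SchwartzMap.integrable _).norm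
      (Eventually.of_forall fun X => ?_)
    · exact ((SchwartzMap.continuous _).mul (by fun_prop)).aestronglyMeasurable
    · filter_upwards [self_mem_nhdsWithin] with δ hδ
      refine Eventually.of_forall fun X => ?_
      rw [norm_mul]
      exact mul_le_of_le_one_right (norm_nonneg _) (norm_gauss_le_one (le_of_lt hδ) X)
    · have h : Continuous fun δ : ℝ => fourierSchwartz φ X *
          Complex.exp (-∑ j, gaussCoeff c δ j * (X j : ℂ) ^ 2) := by fun_prop
      have h0 := (h.tendsto 0).mono_left (nhdsWithin_le_nhds (s := Ioi 0))
      refine h0.trans (le_of_eq ?_)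
      congr 3
      rw [Fin.sum_univ_four]
      change -((((0 : ℝ) : ℂ) - Complex.I * c) * X 0 ^ 2 + (((0 : ℝ) : ℂ) - Complex.I * c) * X 1 ^ 2
        + (((0 : ℝ) : ℂ) + Complex.I * c) * X 2 ^ 2 + (((0 : ℝ) : ℂ) + Complex.I * c) * X 3 ^ 2) = _
      simp only [N]
      push_cast
      ring
  have hR : Tendsto (fun δ : ℝ => (4 * (δ ^ 2 + c ^ 2) : ℂ)⁻¹ *
        ∫ ξ, φ ξ * Complex.exp (-∑ j, (ξ j : ℂ) ^ 2 / (4 * gaussCoeff c δ j))) (𝓝[>] 0)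
      (𝓝 ((4 * c ^ 2 : ℂ)⁻¹ *
        ∫ ξ, φ ξ * Complex.exp (((-N ξ / (4 * c) : ℝ) : ℂ) * Complex.I))) := by
    refine Tendsto.mul ?_ ?_
    · have : ContinuousAt (fun δ : ℝ => (4 * (δ ^ 2 + c ^ 2) : ℂ)⁻¹) 0 := by
        refine ContinuousAt.inv₀ (by fun_prop) ?_
        simp [hc]
      simpa using this.tendsto.mono_left (nhdsWithin_le_nhds (s := Ioi 0))
    · refine tendsto_integral_filter_of_dominated_convergence (fun ξ => ‖φ ξ‖)
        (Eventually.of_forall fun δ => ?_) ?_ (SchwartzMap.integrable _).norm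
        (Eventually.of_forall fun X => ?_)
      · exact ((SchwartzMap.continuous _).mul (by fun_prop)).aestronglyMeasurable
      · filter_upwards [self_mem_nhdsWithin] with δ hδ
        refine Eventually.of_forall fun X => ?_
        rw [norm_mul]
        exact mul_le_of_le_one_right (norm_nonneg _) (norm_gauss_inv_le_one (le_of_lt hδ) X)
      · have h : Continuous fun δ : ℝ => φ X *
            Complex.exp (-∑ j, (X j : ℂ) ^ 2 / (4 * gaussCoeff c δ j)) := by
          refine continuous_const.mul (Complex.continuous_exp.comp (Continuous.neg
            (continuous_finsetSum _ fun j _ => continuous_const.div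
              (continuous_const.mul (hg j)) fun δ => ?_)))
          exact mul_ne_zero (by norm_num) (gaussCoeff_ne_zero hc δ j)
        have h0 := (h.tendsto 0).mono_left (nhdsWithin_le_nhds (s := Ioi 0))
        refine h0.trans (le_of_eq ?_)
        congr 3
        rw [Fin.sum_univ_four]
        change -(X 0 ^ 2 / (4 * (((0 : ℝ) : ℂ) - Complex.I * c))
          + X 1 ^ 2 / (4 * (((0 : ℝ) : ℂ) - Complex.I * c))
          + X 2 ^ 2 / (4 * (((0 : ℝ) : ℂ) + Complex.I * c))
          + X 3 ^ 2 / (4 * (((0 : ℝ) : ℂ) + Complex.I * c))) = _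
        simp only [N, Complex.ofReal_zero, zero_sub, zero_add]
        push_cast
        have hI := Complex.I_ne_zero
        field_simp
        rw [Complex.I_sq]
        ring
  refine tendsto_nhds_unique hL (hR.congr' ?_)
  filter_upwards [self_mem_nhdsWithin] with δ hδ
  exact (integral_fourierSchwartz_mul_damped hδ φ).symm

theorem laplace_id {z : ℂ} (hz : 0 < z.re) : laplace (fun t => (t : ℂ)) z = 1 / z ^ 2 := by
  have hz0 : z ≠ 0 := fun h => by simp [h] at hz
  have h1 := laplaceIntegrable_one.hasDerivAt hz
  have h2 : HasDerivAt (laplace fun _ => 1) (-(z ^ 2)⁻¹) z := by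
    refine (hasDerivAt_inv hz0).congr_of_eventuallyEq ?_
    filter_upwards [(isOpen_lt continuous_const Complex.continuous_re).mem_nhds hz] with y hy
    rw [laplace_one hy, one_div]
  have h3 := neg_injective (h1.unique h2)
  simp only [mul_one] at h3
  rw [h3, one_div]

/-- The density `t e^{-δ/t}`; the factor `e^{-δ/t}` compensates the factor `t⁻²` that the Fourier
transform of a Gaussian brings in at `t = 0`. -/
theorem laplaceIntegrable_regularized {δ : ℝ} (hδ : 0 ≤ δ) :
    LaplaceIntegrable (fun t => t * Complex.exp (-(δ : ℂ) / t)) :=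
  (laplaceIntegrable_expK (b := δ) (by simpa using hδ)).id_mul

/-- The Fourier transform of a regularization of `(N + c + i s ε)⁻²`, as a superposition of
imaginary Gaussians. Here `a = ε - i s c`. -/
theorem integral_fourierSchwartz_mul_regularized {a : ℂ} (ha : 0 < a.re) {s δ : ℝ}
    (hs : s ^ 2 = 1) (hδ : 0 < δ) (φ : 𝓢(SplitQuat, ℂ)) :
    ∫ X, fourierSchwartz φ X *
        laplace (fun t => t * Complex.exp (-(δ : ℂ) / t)) (a - Complex.I * s * N X)
      = (1 / 4 : ℂ) * ∫ ξ, φ ξ * besselM a (δ + Complex.I * s * N ξ / 4) := by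
  have hs0 : s ≠ 0 := fun h => by simp [h] at hs
  have hδ' : 0 < (δ : ℂ).re := by simpa using hδ
  have hm := measurable_N
  have hsC : (s : ℂ) ^ 2 = 1 := by exact_mod_cast hs
  have hsw1 := integral_mul_integral_swap ((fourierSchwartz φ).integrable (μ := volume))
    ((laplaceIntegrable_regularized hδ.le).integrable ha)
    (k := fun X t => Complex.exp (((s * t * N X : ℝ) : ℂ) * Complex.I))
    (by unfold Function.uncurry; fun_prop) (fun X t => by rw [Complex.norm_exp_ofReal_mul_I])
  have hsw2 := integral_mul_integral_swap (φ.integrable (μ := volume))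
    ((laplaceIntegrable_kernM hδ').integrable ha)
    (k := fun ξ t => Complex.exp (((-N ξ / (4 * (s * t)) : ℝ) : ℂ) * Complex.I))
    (by unfold Function.uncurry; fun_prop) (fun X t => by rw [Complex.norm_exp_ofReal_mul_I])
  have e1 : ∀ X, laplace (fun t => t * Complex.exp (-(δ : ℂ) / t)) (a - Complex.I * s * N X)
      = ∫ t in Ioi (0 : ℝ), t * Complex.exp (-(δ : ℂ) / t) * Complex.exp (-a * t) *
        Complex.exp (((s * t * N X : ℝ) : ℂ) * Complex.I) := fun X => by
    refine setIntegral_congr_fun measurableSet_Ioi fun t _ => ?_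
    simp only
    rw [mul_assoc _ (Complex.exp (-a * t)), ← Complex.exp_add]
    congr 2
    push_cast
    ring
  have e2 : ∀ ξ, besselM a (δ + Complex.I * s * N ξ / 4)
      = ∫ t in Ioi (0 : ℝ), Complex.exp (-(δ : ℂ) / t) / t * Complex.exp (-a * t) *
        Complex.exp (((-N ξ / (4 * (s * t)) : ℝ) : ℂ) * Complex.I) := fun ξ => by
    refine setIntegral_congr_fun measurableSet_Ioi fun t ht => ?_
    have h0 : (t : ℂ) ≠ 0 := by exact_mod_cast (ne_of_gt ht)
    have hs1 : (s : ℂ) ≠ 0 := by exact_mod_cast hs0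
    have hN' : -N ξ / (4 * (s * t)) = -(s * N ξ) / (4 * t) := by
      have ht' : t ≠ 0 := ne_of_gt ht
      field_simp
      rw [hs]
      ring
    simp only
    rw [hN', mul_right_comm (Complex.exp (-(δ : ℂ) / t) / t),
      div_mul_eq_mul_div (Complex.exp (-(δ : ℂ) / t)), ← Complex.exp_add]
    congr 3
    push_cast
    field_simp
    ring
  simp only [e1, e2]
  rw [hsw1, hsw2, ← integral_const_mul]
  refine setIntegral_congr_fun measurableSet_Ioi fun t ht => ?_
  have ht' : (0 : ℝ) < t := ht
  have h0 : (t : ℂ) ≠ 0 := by exact_mod_cast (ne_of_gt ht)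
  have hs1 : (s : ℂ) ≠ 0 := by exact_mod_cast hs0
  rw [integral_fourierSchwartz_mul_cexp_N (mul_ne_zero hs0 ht'.ne')]
  generalize (∫ ξ, φ ξ *
    Complex.exp (((-N ξ / (4 * (s * t)) : ℝ) : ℂ) * Complex.I)) = J
  push_cast
  rw [mul_pow, hsC]
  field_simp

theorem besselL_continuousAt {w : ℂ} (hw : w ∈ Complex.slitPlane) : ContinuousAt besselL w := by
  unfold besselL
  exact (((continuousAt_clog hw).add continuousAt_const).neg.mul
    continuous_seriesI.continuousAt).add (continuousAt_const.mul continuous_seriesS.continuousAt)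

theorem mul_mem_slitPlane_of_re_pos {a b : ℂ} (ha : 0 < a.re) (hb : 0 < b.re) :
    a * b ∈ Complex.slitPlane := by
  rw [Complex.mem_slitPlane_iff_arg]
  have ha0 : a ≠ 0 := fun h => by simp [h] at ha
  have hb0 : b ≠ 0 := fun h => by simp [h] at hb
  have h1 := abs_lt.mp (Complex.abs_arg_lt_pi_div_two_iff.mpr (Or.inl ha))
  have h2 := abs_lt.mp (Complex.abs_arg_lt_pi_div_two_iff.mpr (Or.inl hb))
  refine ⟨?_, mul_ne_zero ha0 hb0⟩
  rw [Complex.arg_mul ha0 hb0 ⟨by linarith, by linarith⟩]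
  linarith

theorem norm_besselL_le_of_le {w : ℂ} (hw : w ∈ Complex.slitPlane) {r x : ℝ} (hr : 0 < r)
    (hx : x ≠ 0) (h : r * |x| ≤ ‖w‖) :
    ‖besselL w‖ ≤ 6 * r ^ (-(1 / 4) : ℝ) * |x| ^ (-(1 / 4) : ℝ) := by
  have hx' : 0 < |x| := abs_pos.mpr hx
  refine (norm_besselL_le hw).trans ?_
  rw [mul_assoc, ← Real.mul_rpow hr.le hx'.le]
  gcongr 6 * ?_
  exact Real.rpow_le_rpow_of_nonpos (by positivity) h (by norm_num)

theorem measurable_besselL : Measurable besselL := by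
  unfold besselL
  have := continuous_seriesI.measurable
  have := continuous_seriesS.measurable
  fun_prop

/-- The Fourier transform of `(N + c + i s ε)⁻²` for `ε > 0`, obtained by letting `δ → 0` in the
regularized identity. -/
theorem integral_fourierSchwartz_div_sq {s c ε : ℝ} (hs : s ^ 2 = 1) (hε : 0 < ε)
    (φ : 𝓢(SplitQuat, ℂ)) :
    ∫ X, fourierSchwartz φ X / (((N X + c : ℝ) : ℂ) + ((s * ε : ℝ) : ℂ) * Complex.I) ^ 2
      = ∫ ξ, -(1 / 4 : ℂ) * besselL ((c * N ξ + Complex.I * (ε * (s * N ξ))) / 4) * φ ξ := by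
  set a : ℂ := ε - Complex.I * s * c with ha_def
  have hsC : (s : ℂ) ^ 2 = 1 := by exact_mod_cast hs
  have hs0 : s ≠ 0 := fun h => by simp [h] at hs
  have are : a.re = ε := by simp [ha_def]
  have ha : 0 < a.re := by rwa [are]
  have ha0 : 0 < ‖a‖ := norm_pos_iff.mpr fun h => by simp [h] at ha
  have hre : ∀ X, (a - Complex.I * s * N X).re = ε := fun X => by simp [are]
  have hN := measurable_N
  have hbM := measurable_besselL
  have hL : Tendsto (fun δ : ℝ => ∫ X, fourierSchwartz φ X *
      laplace (fun t => t * Complex.exp (-(δ : ℂ) / t)) (a - Complex.I * s * N X)) (𝓝[>] 0)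
      (𝓝 (∫ X, fourierSchwartz φ X * (1 / (a - Complex.I * s * N X) ^ 2))) := by
    have hint := laplaceIntegrable_one.id_mul.integrable (a := (ε : ℂ)) (by simpa using hε)
    refine tendsto_integral_filter_of_dominated_convergence (fun X => ‖fourierSchwartz φ X‖ *
      ∫ t in Ioi (0 : ℝ), ‖(t : ℂ) * 1 * Complex.exp (-(ε : ℂ) * t)‖) ?_ ?_
      ((SchwartzMap.integrable _).norm.mul_const _) (Eventually.of_forall fun X => ?_)
    · filter_upwards [self_mem_nhdsWithin] with δ hδ
      refine (SchwartzMap.continuous _).aestronglyMeasurable.mul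
        (Continuous.aestronglyMeasurable ?_)
      refine continuous_iff_continuousAt.mpr fun X => ?_
      have h1 := ((laplaceIntegrable_regularized (le_of_lt hδ)).hasDerivAt
        (a := a - Complex.I * s * N X) (by rwa [hre X])).continuousAt
      have h2 : ContinuousAt (fun X => a - Complex.I * s * N X) X := by
        have := continuous_N
        fun_prop
      exact ContinuousAt.comp (f := fun X => a - Complex.I * s * N X) h1 h2
    · filter_upwards [self_mem_nhdsWithin] with δ hδ
      refine Eventually.of_forall fun X => ?_
      rw [norm_mul]
      gcongr
      refine norm_integral_le_of_norm_le hint.norm ?_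
      refine (ae_restrict_iff' measurableSet_Ioi).mpr (Eventually.of_forall fun t ht => ?_)
      rw [norm_mul, norm_mul, norm_mul, norm_mul, norm_one, norm_cexp_neg_mul_ofReal,
        norm_cexp_neg_mul_ofReal, hre X, Complex.ofReal_re]
      gcongr
      exact norm_cexp_neg_div_le_one (by simpa using le_of_lt hδ) ht
    · refine Tendsto.const_mul _ ?_
      rw [← laplace_id (by rwa [hre X])]
      refine tendsto_integral_filter_of_dominated_convergence
        (fun t : ℝ => ‖(t : ℂ) * 1 * Complex.exp (-(ε : ℂ) * t)‖) ?_ ?_ hint.norm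
        (Eventually.of_forall fun t => ?_)
      · exact Eventually.of_forall fun δ => Measurable.aestronglyMeasurable (by fun_prop)
      · filter_upwards [self_mem_nhdsWithin] with δ hδ
        refine (ae_restrict_iff' measurableSet_Ioi).mpr (Eventually.of_forall fun t ht => ?_)
        rw [norm_mul, norm_mul, norm_mul, norm_mul, norm_one, norm_cexp_neg_mul_ofReal,
          norm_cexp_neg_mul_ofReal, hre X, Complex.ofReal_re]
        gcongr
        exact norm_cexp_neg_div_le_one (by simpa using le_of_lt hδ) ht
      · have h : Continuous fun δ : ℝ => (t : ℂ) * Complex.exp (-(δ : ℂ) / t) *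
          Complex.exp (-(a - Complex.I * s * N X) * t) := by fun_prop
        simpa using (h.tendsto 0).mono_left (nhdsWithin_le_nhds (s := Ioi 0))
  have hw : ∀ ξ, a * (Complex.I * s * N ξ / 4)
      = (c * N ξ + Complex.I * (ε * (s * N ξ))) / 4 := fun ξ => by
    rw [ha_def]
    linear_combination (-(s : ℂ) ^ 2 * c * N ξ / 4) * Complex.I_sq + (c * N ξ / 4 : ℂ) * hsC
  have hslit : ∀ ξ, N ξ ≠ 0 →
      (c * N ξ + Complex.I * (ε * (s * N ξ)) : ℂ) / 4 ∈ Complex.slitPlane := fun ξ hξ => by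
    right
    have : ((c * N ξ + Complex.I * (ε * (s * N ξ)) : ℂ) / 4).im = ε * (s * N ξ) / 4 := by
      simp
    rw [this]
    have := mul_ne_zero hε.ne' (mul_ne_zero hs0 hξ)
    intro h
    apply this
    linarith
  have hR : Tendsto (fun δ : ℝ => (1 / 4 : ℂ) * ∫ ξ, φ ξ *
      besselL (a * (δ + Complex.I * s * N ξ / 4))) (𝓝[>] 0) (𝓝 ((1 / 4 : ℂ) *
        ∫ ξ, φ ξ * besselL ((c * N ξ + Complex.I * (ε * (s * N ξ))) / 4))) := by
    refine Tendsto.const_mul _ ?_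
    refine tendsto_integral_filter_of_dominated_convergence
      (fun ξ => 6 * (‖a‖ / 4) ^ (-(1 / 4) : ℝ) * (|N ξ| ^ (-(1 / 4) : ℝ) * ‖φ ξ‖)) ?_ ?_
      ((integrable_abs_N_rpow_mul φ).const_mul _) ?_
    · refine Eventually.of_forall fun δ => φ.continuous.aestronglyMeasurable.mul
        (Measurable.aestronglyMeasurable (hbM.comp (by fun_prop)))
    · filter_upwards [self_mem_nhdsWithin] with δ hδ
      have hδ : 0 < δ := hδ
      filter_upwards [ae_N_ne_zero] with ξ hξ
      have hbre : (δ + Complex.I * s * N ξ / 4 : ℂ).re = δ := by simp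
      have him : (δ + Complex.I * s * N ξ / 4 : ℂ).im = s * N ξ / 4 := by simp
      have h := norm_besselL_le_of_le
        (mul_mem_slitPlane_of_re_pos (b := δ + Complex.I * s * N ξ / 4) ha (by rwa [hbre]))
        (r := ‖a‖ / 4) (x := N ξ) (by positivity) hξ (by
          rw [norm_mul]
          have h1 := Complex.abs_im_le_norm (δ + Complex.I * s * N ξ / 4 : ℂ)
          have h2 : |s| = 1 := by
            rwa [← pow_eq_one_iff_of_nonneg (abs_nonneg s) two_ne_zero, sq_abs]
          rw [him, abs_div, abs_mul, h2, one_mul, abs_of_pos (by norm_num : (0:ℝ) < 4)] at h1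
          calc ‖a‖ / 4 * |N ξ| = ‖a‖ * (|N ξ| / 4) := by ring
            _ ≤ _ := by gcongr)
      rw [norm_mul]
      refine (mul_le_mul_of_nonneg_left h (norm_nonneg (φ ξ))).trans (le_of_eq ?_)
      ring
    · filter_upwards [ae_N_ne_zero] with ξ hξ
      refine Tendsto.const_mul _ ?_
      have h1 := (besselL_continuousAt (hslit ξ hξ)).tendsto
      have h2 : Continuous fun δ : ℝ => a * (δ + Complex.I * s * N ξ / 4) := by fun_prop
      have h3 := (h2.tendsto 0).mono_left (nhdsWithin_le_nhds (s := Ioi 0))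
      simp only [Complex.ofReal_zero, zero_add, hw ξ] at h3
      exact h1.comp h3
  have hEq : ∫ X, fourierSchwartz φ X * (1 / (a - Complex.I * s * N X) ^ 2)
      = (1 / 4 : ℂ) * ∫ ξ, φ ξ * besselL ((c * N ξ + Complex.I * (ε * (s * N ξ))) / 4) := by
    refine tendsto_nhds_unique hL (hR.congr' ?_)
    filter_upwards [self_mem_nhdsWithin] with δ hδ
    have hδ : 0 < δ := hδ
    rw [integral_fourierSchwartz_mul_regularized ha hs hδ]
    congr 1
    refine integral_congr_ae (Eventually.of_forall fun ξ => ?_)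
    simp only
    rw [besselM_eq_besselL ha (by simpa using hδ)]
  calc _ = -∫ X, fourierSchwartz φ X * (1 / (a - Complex.I * s * N X) ^ 2) := by
        rw [← integral_neg]
        refine integral_congr_ae (Eventually.of_forall fun X => ?_)
        simp only
        have h : (((N X + c : ℝ) : ℂ) + ((s * ε : ℝ) : ℂ) * Complex.I) ^ 2
            = -(a - Complex.I * s * N X) ^ 2 := by
          have h1 : ((N X + c : ℝ) : ℂ) + ((s * ε : ℝ) : ℂ) * Complex.I
              = Complex.I * s * (a - Complex.I * s * N X) := by
            rw [ha_def]
            push_cast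
            linear_combination (-(N X + c : ℂ)) * hsC + (s : ℂ) ^ 2 * (N X + c) * Complex.I_sq
          rw [h1, mul_pow, mul_pow, Complex.I_sq, hsC]
          ring
        rw [h, div_neg, mul_one_div]
    _ = _ := by
        rw [hEq, ← integral_const_mul, ← integral_neg]
        refine integral_congr_ae (Eventually.of_forall fun ξ => ?_)
        simp only
        ring

/-! ### The boundary value and its Fourier transform -/

/-- The inverse of `fourierSchwartz`, obtained by rescaling the inverse Fourier transform of Mathlib. -/
noncomputable def fourierSchwartzInv : 𝓢(SplitQuat, ℂ) →L[ℂ] 𝓢(SplitQuat, ℂ) :=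
  (((2 * Real.pi) ^ 2 : ℝ) : ℂ) •
    ((FourierTransform.fourierInvCLM ℂ 𝓢(SplitQuat, ℂ)) ∘L
      (SchwartzMap.compCLMOfContinuousLinearEquiv ℂ
        (ContinuousLinearEquiv.smulLeft (M₁ := SplitQuat) (R₁ := ℝ)
          (Units.mk0 (-(2 * Real.pi)⁻¹) (by simp [Real.pi_ne_zero]))).symm))

theorem fourierSchwartz_fourierSchwartzInv (φ : 𝓢(SplitQuat, ℂ)) :
    fourierSchwartz (fourierSchwartzInv φ) = φ := by
  have hpi : (((2 * Real.pi) ^ 2 : ℝ) : ℂ) ≠ 0 := by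
    exact_mod_cast (by positivity : (2 * Real.pi) ^ 2 ≠ 0)
  have hcomp : ∀ (e : SplitQuat ≃L[ℝ] SplitQuat) (ψ : 𝓢(SplitQuat, ℂ)),
      SchwartzMap.compCLMOfContinuousLinearEquiv ℂ e
        (SchwartzMap.compCLMOfContinuousLinearEquiv ℂ e.symm ψ) = ψ := fun e ψ => by
    ext x
    simp
  simp only [fourierSchwartz, fourierSchwartzInv, smul_apply, ContinuousLinearMap.comp_apply,
    map_smul, smul_smul, mul_inv_cancel₀ hpi, one_smul, hcomp,
    FourierTransform.fourierCLM_apply,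
    FourierTransform.fourierInvCLM_apply, FourierTransform.fourier_fourierInv_eq]

theorem fourierSchwartzInv_fourierSchwartz (φ : 𝓢(SplitQuat, ℂ)) :
    fourierSchwartzInv (fourierSchwartz φ) = φ := by
  have hpi : (((2 * Real.pi) ^ 2 : ℝ) : ℂ) ≠ 0 := by
    exact_mod_cast (by positivity : (2 * Real.pi) ^ 2 ≠ 0)
  have hcomp : ∀ (e : SplitQuat ≃L[ℝ] SplitQuat) (ψ : 𝓢(SplitQuat, ℂ)),
      SchwartzMap.compCLMOfContinuousLinearEquiv ℂ e.symm
        (SchwartzMap.compCLMOfContinuousLinearEquiv ℂ e ψ) = ψ := fun e ψ => by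
    ext x
    simp
  simp only [fourierSchwartz, fourierSchwartzInv, smul_apply, ContinuousLinearMap.comp_apply,
    map_smul, smul_smul, inv_mul_cancel₀ hpi, one_smul, hcomp,
    FourierTransform.fourierCLM_apply,
    FourierTransform.fourierInvCLM_apply, FourierTransform.fourierInv_fourier_eq]

/-- The distribution is built on the Fourier side: integration against the limit kernel `K` is a
tempered distribution, and its composition with the inverse Fourier transform is the limit of
`(N + c + i s ε)⁻²`. -/
theorem exists_boundaryValue_isGivenBy {c s : ℝ} (hc : c ≠ 0) (hs : s ^ 2 = 1)
    {K : SplitQuat → ℂ}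
    (hK : ∀ ξ, N ξ ≠ 0 → Tendsto (fun ε : ℝ =>
      -(1 / 4 : ℂ) * besselL ((c * N ξ + Complex.I * (ε * (s * N ξ))) / 4)) (𝓝[>] 0) (𝓝 (K ξ))) :
    ∃ T : 𝓢'(SplitQuat, ℂ), IsInvSqBoundaryValue c s T ∧
      IsGivenBy (fourierDistribution T) K := by
  have hs0 : s ≠ 0 := fun h => by simp [h] at hs
  have hN := measurable_N
  have hbM := measurable_besselL
  set C : ℝ := 1 / 4 * (6 * (|c| / 4) ^ (-(1 / 4) : ℝ)) with hC
  have hC0 : 0 ≤ C := by positivity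
  have hbound : ∀ ε : ℝ, 0 < ε → ∀ ξ, N ξ ≠ 0 →
      ‖-(1 / 4 : ℂ) * besselL ((c * N ξ + Complex.I * (ε * (s * N ξ))) / 4)‖
        ≤ C * |N ξ| ^ (-(1 / 4) : ℝ) := fun ε hε ξ hξ => by
    have him : ((c * N ξ + Complex.I * (ε * (s * N ξ)) : ℂ) / 4).im = ε * (s * N ξ) / 4 := by simp
    have hre : ((c * N ξ + Complex.I * (ε * (s * N ξ)) : ℂ) / 4).re = c * N ξ / 4 := by simp
    have hsl : ((c * N ξ + Complex.I * (ε * (s * N ξ)) : ℂ) / 4) ∈ Complex.slitPlane := by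
      right
      rw [him]
      positivity
    have h := norm_besselL_le_of_le hsl (r := |c| / 4) (by positivity) hξ (by
      have h1 := Complex.abs_re_le_norm ((c * N ξ + Complex.I * (ε * (s * N ξ)) : ℂ) / 4)
      rw [hre, abs_div, abs_mul, abs_of_pos (by norm_num : (0 : ℝ) < 4)] at h1
      linarith)
    rw [norm_mul, norm_neg, hC, mul_assoc]
    norm_num
    norm_num at h
    linarith
  have hKbound : ∀ ξ, N ξ ≠ 0 → ‖K ξ‖ ≤ C * |N ξ| ^ (-(1 / 4) : ℝ) := fun ξ hξ => by
    refine le_of_tendsto (hK ξ hξ).norm ?_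
    filter_upwards [self_mem_nhdsWithin] with ε hε
    exact hbound ε hε ξ hξ
  have hKm : AEStronglyMeasurable K := by
    refine aestronglyMeasurable_of_tendsto_ae (𝓝[>] (0 : ℝ)) (f := fun ε ξ =>
      -(1 / 4 : ℂ) * besselL ((c * N ξ + Complex.I * (ε * (s * N ξ))) / 4)) (fun ε => ?_) ?_
    · exact (Measurable.const_mul (hbM.comp (by fun_prop)) _).aestronglyMeasurable
    · filter_upwards [ae_N_ne_zero] with ξ hξ using hK ξ hξ
  have hint : ∀ φ : 𝓢(SplitQuat, ℂ), Integrable fun ξ => K ξ * φ ξ := fun φ => by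
    refine ((integrable_abs_N_rpow_mul φ).const_mul C).mono'
      (hKm.mul φ.continuous.aestronglyMeasurable) ?_
    filter_upwards [ae_N_ne_zero] with ξ hξ
    rw [norm_mul, ← mul_assoc]
    gcongr
    exact hKbound ξ hξ
  set L : 𝓢(SplitQuat, ℂ) →L[ℂ] ℂ := SchwartzMap.mkCLMtoNormedSpace (σ := RingHom.id ℂ)
    (fun φ => ∫ ξ, K ξ * φ ξ)
    (fun φ ψ => by
      simp only [add_apply, mul_add]
      exact integral_add (hint φ) (hint ψ))
    (fun a φ => by
      simp only [smul_apply, smul_eq_mul, RingHom.id_apply, ← integral_const_mul]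
      refine integral_congr_ae (Eventually.of_forall fun ξ => ?_)
      simp only
      ring)
    (by
      refine ⟨Finset.Iic (6, 0), C * (2 ^ 6 *
        ∫ ξ, |N ξ| ^ (-(1 / 4) : ℝ) * (1 + ‖ξ‖) ^ (-(6 : ℝ))), by positivity, fun φ => ?_⟩
      have h1 : ‖∫ ξ, K ξ * φ ξ‖ ≤ ∫ ξ, C * (2 ^ 6 *
          ((Finset.Iic (6, 0)).sup (schwartzSeminormFamily ℂ SplitQuat ℂ)) φ) *
          (|N ξ| ^ (-(1 / 4) : ℝ) * (1 + ‖ξ‖) ^ (-(6 : ℝ))) := by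
        refine norm_integral_le_of_norm_le (integrable_abs_N_rpow.const_mul _) ?_
        filter_upwards [ae_N_ne_zero] with ξ hξ
        rw [norm_mul]
        have h2 := norm_schwartz_le φ ξ
        calc ‖K ξ‖ * ‖φ ξ‖ ≤ (C * |N ξ| ^ (-(1 / 4) : ℝ)) * _ :=
              mul_le_mul (hKbound ξ hξ) h2 (norm_nonneg _) (by positivity)
          _ = _ := by ring
      rw [integral_const_mul] at h1
      refine h1.trans (le_of_eq ?_)
      ring) with hLdef
  have hL : ∀ φ, L φ = ∫ ξ, K ξ * φ ξ := fun φ => rfl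
  refine ⟨ContinuousLinearMap.toPointwiseConvergenceCLM _ _ _ _ (L ∘L fourierSchwartzInv),
    fun ψ => ?_, fun φ => ⟨hint φ, ?_⟩⟩
  · change Tendsto _ _ (𝓝 (L (fourierSchwartzInv ψ)))
    rw [hL]
    set φ := fourierSchwartzInv ψ with hφ
    have hψ : ψ = fourierSchwartz φ := (fourierSchwartz_fourierSchwartzInv ψ).symm
    rw [hψ]
    have key : Tendsto (fun ε : ℝ => ∫ ξ, -(1 / 4 : ℂ) *
        besselL ((c * N ξ + Complex.I * (ε * (s * N ξ))) / 4) * φ ξ) (𝓝[>] 0)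
        (𝓝 (∫ ξ, K ξ * φ ξ)) := by
      refine tendsto_integral_filter_of_dominated_convergence
        (fun ξ => C * (|N ξ| ^ (-(1 / 4) : ℝ) * ‖φ ξ‖)) ?_ ?_
        ((integrable_abs_N_rpow_mul φ).const_mul C) ?_
      · exact Eventually.of_forall fun ε =>
          (Measurable.const_mul (hbM.comp (by fun_prop)) _).aestronglyMeasurable.mul
            φ.continuous.aestronglyMeasurable
      · filter_upwards [self_mem_nhdsWithin] with ε hε
        filter_upwards [ae_N_ne_zero] with ξ hξ
        rw [norm_mul, ← mul_assoc C]
        gcongr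
        exact hbound ε hε ξ hξ
      · filter_upwards [ae_N_ne_zero] with ξ hξ using (hK ξ hξ).mul_const _
    refine key.congr' ?_
    filter_upwards [self_mem_nhdsWithin] with ε hε
    exact (integral_fourierSchwartz_div_sq hs hε φ).symm
  · rw [fourierDistribution_apply]
    change L (fourierSchwartzInv (fourierSchwartz φ)) = _
    rw [fourierSchwartzInv_fourierSchwartz, hL]

/-! ### Identification of the kernels -/

theorem seriesI_sq_div (r : ℝ) : seriesI ((r : ℂ) ^ 2 / 4) = besselI0 r := by
  rw [seriesI, powSum, besselI0, Complex.ofReal_tsum]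
  refine tsum_congr fun k => ?_
  rw [coeffI]
  push_cast
  rw [pow_mul]
  congr 2
  ring

theorem seriesI_neg_sq_div (r : ℝ) : seriesI (-((r : ℂ) ^ 2 / 4)) = besselJ0 r := by
  rw [seriesI, powSum, besselJ0, Complex.ofReal_tsum]
  refine tsum_congr fun k => ?_
  rw [coeffI]
  push_cast
  rw [pow_mul, show (-((r : ℂ) ^ 2 / 4)) = -1 * ((r / 2 : ℂ) ^ 2) by ring, mul_pow]
  ring

theorem besselL_sq_div {r : ℝ} (hr : 0 < r) :
    besselL ((r : ℂ) ^ 2 / 4) = 2 * (besselK0 r : ℂ) := by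
  have hlog : Complex.log ((r : ℂ) ^ 2 / 4) = 2 * (Real.log (r / 2) : ℂ) := by
    rw [show (r : ℂ) ^ 2 / 4 = (((r / 2) ^ 2 : ℝ) : ℂ) by push_cast; ring,
      ← Complex.ofReal_log (by positivity), Real.log_pow]
    push_cast
    ring
  have hS : seriesS ((r : ℂ) ^ 2 / 4) = ((∑' k : ℕ, (harmonic k : ℝ) / (k.factorial : ℝ) ^ 2 *
      (r / 2) ^ (2 * k) : ℝ) : ℂ) := by
    rw [seriesS, powSum, Complex.ofReal_tsum]
    refine tsum_congr fun k => ?_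
    rw [coeffS]
    push_cast
    rw [pow_mul]
    congr 2
    ring
  rw [besselL, hlog, hS, seriesI_sq_div, besselK0]
  push_cast
  ring

/-- The boundary values of `2 K₀(2√w)` on the two sides of the cut, `σ` being the side. -/
theorem tendsto_besselL_neg {x d : ℝ} (hx : x < 0) {σ : ℝ}
    (hσ : 0 < d ∧ σ = 1 ∨ d < 0 ∧ σ = -1) :
    Tendsto (fun ε : ℝ => besselL (x + Complex.I * (ε * d))) (𝓝[>] 0)
      (𝓝 (-((Real.log (-x) : ℂ) + σ * (Real.pi * Complex.I) + 2 * Real.eulerMascheroniConstant) *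
        seriesI x + 2 * seriesS x)) := by
  have hpath : Tendsto (fun ε : ℝ => (x + Complex.I * (ε * d) : ℂ)) (𝓝[>] 0) (𝓝 (x : ℂ)) := by
    have h : Continuous fun ε : ℝ => (x + Complex.I * (ε * d) : ℂ) := by fun_prop
    simpa using (h.tendsto 0).mono_left (nhdsWithin_le_nhds (s := Ioi 0))
  have hnorm : ‖(x : ℂ)‖ = -x := by
    rw [Complex.norm_real, Real.norm_of_nonpos hx.le]
  have hlog : Tendsto (fun ε : ℝ => Complex.log (x + Complex.I * (ε * d))) (𝓝[>] 0)
      (𝓝 ((Real.log (-x) : ℂ) + σ * (Real.pi * Complex.I))) := by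
    rcases hσ with ⟨hd, rfl⟩ | ⟨hd, rfl⟩
    · have h := Complex.tendsto_log_nhdsWithin_im_nonneg_of_re_neg_of_im_zero
        (z := (x : ℂ)) (by simpa using hx) (by simp)
      rw [hnorm] at h
      simp only [Complex.ofReal_one, one_mul]
      refine h.comp (tendsto_nhdsWithin_iff.mpr ⟨hpath, ?_⟩)
      filter_upwards [self_mem_nhdsWithin] with ε hε
      have hε : 0 < ε := hε
      simp only [Complex.add_im, Complex.ofReal_im, Complex.mul_im, Complex.I_re,
        Complex.I_im, Complex.mul_re, Complex.ofReal_re, mul_zero, sub_zero, zero_mul, zero_add,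
        one_mul]
      positivity
    · have h := Complex.tendsto_log_nhdsWithin_im_neg_of_re_neg_of_im_zero
        (z := (x : ℂ)) (by simpa using hx) (by simp)
      rw [hnorm, sub_eq_add_neg] at h
      simp only [Complex.ofReal_neg, Complex.ofReal_one, neg_mul, one_mul]
      refine h.comp (tendsto_nhdsWithin_iff.mpr ⟨hpath, ?_⟩)
      filter_upwards [self_mem_nhdsWithin] with ε hε
      have hε : 0 < ε := hε
      simp only [Complex.add_im, Complex.ofReal_im, Complex.mul_im, Complex.I_re,
        Complex.I_im, Complex.mul_re, Complex.ofReal_re, mul_zero, sub_zero, zero_mul, zero_add,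
        one_mul]
      exact mul_neg_of_pos_of_neg hε hd
  exact ((hlog.add_const _).neg.mul ((continuous_seriesI.tendsto _).comp hpath)).add
    (((continuous_seriesS.tendsto _).comp hpath).const_mul 2)

theorem tendsto_besselL_neg_sq_div {r d : ℝ} (hr : 0 < r) {σ : ℝ}
    (hσ : 0 < d ∧ σ = 1 ∨ d < 0 ∧ σ = -1) :
    Tendsto (fun ε : ℝ => -(1 / 4 : ℂ) * besselL (-((r : ℂ) ^ 2 / 4) + Complex.I * (ε * d)))
      (𝓝[>] 0) (𝓝 (((Real.pi / 4 * besselY0 r : ℝ) : ℂ)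
        + Complex.I * ((σ * (Real.pi / 4) * besselJ0 r : ℝ) : ℂ))) := by
  have h := (tendsto_besselL_neg (x := -(r ^ 2 / 4)) (by linarith [pow_pos hr 2])
    hσ).const_mul (-(1 / 4 : ℂ))
  have hlog : Real.log (- -(r ^ 2 / 4)) = 2 * Real.log (r / 2) := by
    rw [neg_neg, show r ^ 2 / 4 = (r / 2) ^ 2 by ring, Real.log_pow]
    push_cast
    ring
  have hS : seriesS (-((r : ℂ) ^ 2 / 4)) = -((∑' k : ℕ, (-1) ^ (k + 1) * (harmonic k : ℝ) /
      (k.factorial : ℝ) ^ 2 * (r / 2) ^ (2 * k) : ℝ) : ℂ) := by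
    rw [seriesS, powSum, Complex.ofReal_tsum, ← tsum_neg]
    refine tsum_congr fun k => ?_
    rw [coeffS]
    push_cast
    rw [pow_mul, show (-((r : ℂ) ^ 2 / 4)) = -1 * ((r / 2 : ℂ) ^ 2) by ring, mul_pow, pow_succ]
    ring
  rw [hlog] at h
  push_cast at h
  refine (h.trans (le_of_eq ?_))
  congr 1
  rw [seriesI_neg_sq_div, hS, besselY0]
  have hpi : (Real.pi : ℂ) ≠ 0 := by exact_mod_cast Real.pi_ne_zero
  push_cast
  field_simp
  ring

theorem tendsto_besselL_sq_div {r d : ℝ} (hr : 0 < r) :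
    Tendsto (fun ε : ℝ => -(1 / 4 : ℂ) * besselL ((r : ℂ) ^ 2 / 4 + Complex.I * (ε * d)))
      (𝓝[>] 0) (𝓝 ((-(1 / 2) * besselK0 r : ℝ) : ℂ)) := by
  have hsl : ((r : ℂ) ^ 2 / 4) ∈ Complex.slitPlane := by
    left
    rw [show (r : ℂ) ^ 2 / 4 = (((r / 2) ^ 2 : ℝ) : ℂ) by push_cast; ring, Complex.ofReal_re]
    positivity
  have hpath : Tendsto (fun ε : ℝ => ((r : ℂ) ^ 2 / 4 + Complex.I * (ε * d) : ℂ)) (𝓝[>] 0)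
      (𝓝 ((r : ℂ) ^ 2 / 4)) := by
    have h : Continuous fun ε : ℝ => ((r : ℂ) ^ 2 / 4 + Complex.I * (ε * d) : ℂ) := by fun_prop
    simpa using (h.tendsto 0).mono_left (nhdsWithin_le_nhds (s := Ioi 0))
  have h := ((besselL_continuousAt hsl).tendsto.comp hpath).const_mul (-(1 / 4 : ℂ))
  refine h.trans (le_of_eq ?_)
  rw [besselL_sq_div hr]
  congr 1
  push_cast
  ring

theorem ofReal_mul_sqrt_sq_div {R q : ℝ} (hq : 0 ≤ q) :
    ((R * √q : ℝ) : ℂ) ^ 2 / 4 = R ^ 2 * q / 4 := by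
  rw [← Complex.ofReal_pow, mul_pow, Real.sq_sqrt hq]
  push_cast
  ring

/-- For `q > 0` the side of the cut is `s` itself. -/
theorem side_of_mul {s q : ℝ} (hs : s = 1 ∨ s = -1) (hq : 0 < q) :
    0 < s * q / 4 ∧ s = 1 ∨ s * q / 4 < 0 ∧ s = -1 := by
  rcases hs with rfl | rfl
  · exact Or.inl ⟨by linarith, rfl⟩
  · exact Or.inr ⟨by linarith, rfl⟩

theorem tendsto_kernelMinus {R s : ℝ} (hR : 0 < R) (hs : s = 1 ∨ s = -1) {ξ : SplitQuat}
    (hξ : N ξ ≠ 0) : Tendsto (fun ε : ℝ => -(1 / 4 : ℂ) *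
      besselL (((-R ^ 2 : ℝ) * N ξ + Complex.I * (ε * (s * N ξ))) / 4)) (𝓝[>] 0)
      (𝓝 (kernelMinus R s ξ)) := by
  rw [kernelMinus, dualForm_self]
  rcases lt_or_gt_of_ne hξ with h | h
  · rw [if_neg h.not_gt, if_pos h]
    have h' : 0 < -N ξ := neg_pos.mpr h
    have key := tendsto_besselL_sq_div (r := R * √(-N ξ)) (d := s * N ξ / 4)
      (mul_pos hR (Real.sqrt_pos.mpr h'))
    rw [ofReal_mul_sqrt_sq_div h'.le] at key
    refine key.congr fun ε => ?_
    congr 2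
    push_cast
    ring
  · rw [if_pos h]
    have key := tendsto_besselL_neg_sq_div (r := R * √(N ξ)) (d := s * N ξ / 4)
      (mul_pos hR (Real.sqrt_pos.mpr h)) (side_of_mul hs h)
    rw [ofReal_mul_sqrt_sq_div h.le] at key
    refine key.congr fun ε => ?_
    congr 2
    push_cast
    ring

theorem tendsto_kernelPlus {R s : ℝ} (hR : 0 < R) (hs : s = 1 ∨ s = -1) {ξ : SplitQuat}
    (hξ : N ξ ≠ 0) : Tendsto (fun ε : ℝ => -(1 / 4 : ℂ) *
      besselL (((R ^ 2 : ℝ) * N ξ + Complex.I * (ε * (s * N ξ))) / 4)) (𝓝[>] 0)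
      (𝓝 (kernelPlus R s ξ)) := by
  rw [kernelPlus, dualForm_self]
  rcases lt_or_gt_of_ne hξ with h | h
  · rw [if_neg h.not_gt, if_pos h]
    have h' : 0 < -N ξ := neg_pos.mpr h
    -- As `N ξ < 0`, the argument approaches the cut from the side `-s`.
    have key := tendsto_besselL_neg_sq_div (r := R * √(-N ξ)) (d := -s * -N ξ / 4)
      (mul_pos hR (Real.sqrt_pos.mpr h'))
      (side_of_mul (s := -s) (by rcases hs with rfl | rfl <;> simp) h')
    rw [ofReal_mul_sqrt_sq_div h'.le] at key
    refine (key.congr fun ε => ?_).trans (le_of_eq ?_)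
    · congr 2
      push_cast
      ring
    · congr 1
      push_cast
      ring
  · rw [if_pos h]
    have key := tendsto_besselL_sq_div (r := R * √(N ξ)) (d := s * N ξ / 4)
      (mul_pos hR (Real.sqrt_pos.mpr h))
    rw [ofReal_mul_sqrt_sq_div h.le] at key
    refine key.congr fun ε => ?_
    congr 2
    push_cast
    ring

end SplitQuat

theorem mainTheorem3 (R : ℝ) (hR : 0 < R) (s : ℝ) (hs : s = 1 ∨ s = -1) :
    (∃ T : 𝓢'(SplitQuat, ℂ), SplitQuat.IsInvSqBoundaryValue (-R ^ 2) s T ∧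
      SplitQuat.IsGivenBy (SplitQuat.fourierDistribution T) (SplitQuat.kernelMinus R s)) ∧
    (∃ T : 𝓢'(SplitQuat, ℂ), SplitQuat.IsInvSqBoundaryValue (R ^ 2) s T ∧
      SplitQuat.IsGivenBy (SplitQuat.fourierDistribution T) (SplitQuat.kernelPlus R s)) := by
  have hs2 : s ^ 2 = 1 := by rcases hs with rfl | rfl <;> norm_num
  have hR2 : R ^ 2 ≠ 0 := by positivity
  exact ⟨SplitQuat.exists_boundaryValue_isGivenBy (neg_ne_zero.mpr hR2) hs2
      fun _ hξ => SplitQuat.tendsto_kernelMinus hR hs hξ,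
    SplitQuat.exists_boundaryValue_isGivenBy hR2 hs2
      fun _ hξ => SplitQuat.tendsto_kernelPlus hR hs hξ⟩
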